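/- Let $\gamma\subset\mathbb R^2$ be a simple closed convex curve of class $C^2$ (for example, a smooth one), with a regular positively oriented parametrization $\gamma(t)$, whose curvature vanishes at some point. Let $\omega$ be the standard area form and let $$\mathcal P=\{(x,y)\in\gamma\times\gamma : \omega(\nu_x,\nu_y)>0\}$$ be the (open) phase space, where $\nu_x$ denotes the outer unit normal of $\gamma$ at $x$; topologically it is an open annulus. The symplectic billiard map $\Phi:\mathcal P\to\mathcal P$ is $\Phi(x,y)=(y,z)$, where $z\in\gamma$, $z\ne x$, is the unique other point of $\gamma$ with $z-x$ parallel to the tangent line $T_y\gamma$. Then the symplectic billiard in $\gamma$ has no caustics: there is no $\Phi$-invariant circle, that is, no simple closed curve in $\mathcal P$ that is non-contractible in $\mathcal P$ and is mapped into itself by $\Phi$. -/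

import Mathlib

namespace SymplecticBilliard

/-- The Euclidean plane. -/
abbrev Plane : Type := EuclideanSpace ℝ (Fin 2)

/-- The standard area form `ω` of the plane. -/
def area (u v : Plane) : ℝ := u 0 * v 1 - u 1 * v 0

/-- `γ` is a regular `L`-periodic parametrization of a simple closed convex planar curve of
class `C²`, positively oriented. Convexity: the curve lies in the closed left half-plane of each
of its oriented tangent lines. Flat pieces are allowed, so this covers both convex and strictly
convex curves. -/
structure IsClosedConvexCurve (γ : ℝ → Plane) (L : ℝ) : Prop where
  period_pos : 0 < L
  contDiff : ContDiff ℝ 2 γ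
  regular : ∀ t, deriv γ t ≠ 0
  periodic : Function.Periodic γ L
  simple : Set.InjOn γ (Set.Ico 0 L)
  convex : ∀ t s, 0 ≤ area (deriv γ t) (γ s - γ t)

/-- The signed curvature of a regular curve at parameter `t`. -/
noncomputable def curvature (γ : ℝ → Plane) (t : ℝ) : ℝ :=
  area (deriv γ t) (deriv (deriv γ) t) / ‖deriv γ t‖ ^ 3

/-- `v` lies in the tangent direction `T_y γ` of the curve at its point `y`. -/
def IsTangentAt (γ : ℝ → Plane) (y v : Plane) : Prop :=
  ∃ t : ℝ, γ t = y ∧ ∃ a : ℝ, v = a • deriv γ t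

/-- The (open, positive) phase space: pairs `(x, y)` of points of the curve with
`ω(ν_x, ν_y) > 0`, where `ν` is the outer normal. For a positively oriented curve `ν` is the unit
tangent vector turned by `-π/2`, and `ω` is invariant under rotations, so that the condition can
be written with the velocity vectors. For a strictly convex curve it says `x < y < x*`. -/
def phaseSpace (γ : ℝ → Plane) : Set (Plane × Plane) :=
  {p | ∃ s t : ℝ, γ s = p.1 ∧ γ t = p.2 ∧ 0 < area (deriv γ s) (deriv γ t)}

/-- The symplectic billiard map, as a relation: `Φ(x, y) = (y, z)`, where `z ≠ x` is the other
point of the curve on the line through `x` parallel to the tangent line at `y`. -/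
def BilliardStep (γ : ℝ → Plane) (p q : Plane × Plane) : Prop :=
  q.1 = p.2 ∧ q.2 ∈ Set.range γ ∧ q.2 ≠ p.1 ∧ IsTangentAt γ p.2 (q.2 - p.1)

/-- `c` is an invariant circle: a simple closed curve in the phase annulus that is not
contractible there and is mapped to itself by the symplectic billiard map. -/
structure IsInvariantCircle (γ : ℝ → Plane) (c : C(Circle, phaseSpace γ)) : Prop where
  injective : Function.Injective c
  essential : ¬ c.Nullhomotopic
  invariant : ∀ u : Circle, ∃ v : Circle, BilliardStep γ (c u).1 (c v).1

/-- The billiard has a caustic: there is a one-parameter family of chords `x y` of the curve,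
forming an invariant circle of the billiard map (the caustic is the envelope of the family). -/
def HasCaustic (γ : ℝ → Plane) : Prop :=
  ∃ c : C(Circle, phaseSpace γ), IsInvariantCircle γ c

end SymplecticBilliard

namespace SymplecticBilliard

open Set Filter Topology MeasureTheory

/-! The heart is a quantitative form of Mather's argument. Suppose monotone functions `K` and `G`
give orbit segments `K y, y, G y`, with `G` Lipschitz and inverse to `K`. The chord from `K y` to `G
y` is parallel to the tangent at `y`. Comparing nearby segments at `y` and `t₀` bounds a positive
multiple of `t - t₀` by the area of `γ' t - γ' t₀` against a chord. After division by `t - t₀` the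
right side tends to a multiple of `area (γ'' t₀) chord`. At a point of zero curvature both vectors
are parallel to `γ' t₀`, so this limit is zero, a contradiction (`curvature_ne_zero`).

Such a graph is supplied by Birkhoff's theorem for area-preserving twist maps, proved here for the
billiard. A tangent angle unrolls the phase annulus to a strip. On the strip the billiard is a
homeomorphism which carries the horizontal line at height `y` to the vertical line over `y` and
reverses order. The full lift `C` of the circle is closed, invariant and unbounded to the left.

Points below `C` can be seen vertically or horizontally; the billiard carries the horizontal region
onto the vertical one. A winding argument provides the forward invariant `lowRegion`, which contains
the vertical region and meets the horizontal one only inside it. Preservation of a finite area then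
forces the two regions to agree almost everywhere (`ae_mem_vertRegion_iff`). Hence the lower and
right envelopes of `C` are monotone on a set of full measure. The twist estimate makes them
Lipschitz there, and their continuous extensions are `G` and `K` (`exists_graph`).

Only the first derivative of `height` along the curve is needed, never differentiability of the
billiard itself, which may fail at flat points. -/

/-! ### Algebra and calculus of the area form. -/

theorem area_swap (u v : Plane) : area u v = -area v u := by simp only [area]; ring

theorem area_self (u : Plane) : area u u = 0 := by simp only [area]; ring

theorem area_sub_right (u v w : Plane) : area u (v - w) = area u v - area u w := by
  simp only [area, PiLp.sub_apply]; ring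

theorem area_sub_left (u v w : Plane) : area (u - v) w = area u w - area v w := by
  simp only [area, PiLp.sub_apply]; ring

theorem area_smul_right (u v : Plane) (a : ℝ) : area u (a • v) = a * area u v := by
  simp only [area, PiLp.smul_apply, smul_eq_mul]; ring

theorem area_smul_left (u v : Plane) (a : ℝ) : area (a • u) v = a * area u v := by
  simp only [area, PiLp.smul_apply, smul_eq_mul]; ring

theorem continuous_area : Continuous fun p : Plane × Plane => area p.1 p.2 := by
  unfold area; fun_prop

theorem hasDerivAt_coord {f : ℝ → Plane} {f' : Plane} {t : ℝ} (hf : HasDerivAt f f' t)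
    (i : Fin 2) : HasDerivAt (fun t => f t i) (f' i) t :=
  (EuclideanSpace.proj (𝕜 := ℝ) i).hasFDerivAt.comp_hasDerivAt t hf

theorem hasDerivAt_area {f g : ℝ → Plane} {f' g' : Plane} {t : ℝ} (hf : HasDerivAt f f' t)
    (hg : HasDerivAt g g' t) :
    HasDerivAt (fun t => area (f t) (g t)) (area f' (g t) + area (f t) g') t := by
  have hf := hasDerivAt_coord hf
  have hg := hasDerivAt_coord hg
  have := ((hf 0).mul (hg 1)).sub ((hf 1).mul (hg 0))
  refine this.congr_deriv ?_
  simp only [area]; ring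

/-- A vector with vanishing area against a nonzero vector is parallel to it. -/
theorem exists_smul_of_area_eq_zero {u v : Plane} (hu : u ≠ 0) (h : area u v = 0) :
    ∃ a : ℝ, v = a • u := by
  have hn : u 0 ^ 2 + u 1 ^ 2 ≠ 0 := by
    intro h0
    apply hu
    have h1 : u 0 = 0 := by nlinarith [sq_nonneg (u 0), sq_nonneg (u 1)]
    have h2 : u 1 = 0 := by nlinarith [sq_nonneg (u 0), sq_nonneg (u 1)]
    ext i
    fin_cases i <;> simp [h1, h2]
  refine ⟨(u 0 * v 0 + u 1 * v 1) / (u 0 ^ 2 + u 1 ^ 2), ?_⟩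
  simp only [area] at h
  ext i
  fin_cases i
  · simp only [Fin.zero_eta, PiLp.smul_apply, smul_eq_mul]
    field_simp
    linear_combination (-u 1) * h
  · simp only [Fin.mk_one, PiLp.smul_apply, smul_eq_mul]
    field_simp
    linear_combination (u 0) * h

/-- The complex number with the coordinates of a plane vector. -/
def toComplex (v : Plane) : ℂ := ⟨v 0, v 1⟩

theorem toComplex_ne_zero {v : Plane} (h : v ≠ 0) : toComplex v ≠ 0 := by
  intro h0
  apply h
  have h1 := congrArg Complex.re h0
  have h2 := congrArg Complex.im h0
  simp only [toComplex, Complex.zero_re, Complex.zero_im] at h1 h2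
  ext i
  fin_cases i <;> simp [h1, h2]

theorem norm_toComplex (v : Plane) : ‖toComplex v‖ = ‖v‖ := by
  rw [EuclideanSpace.norm_eq, Complex.norm_eq_sqrt_sq_add_sq]
  simp [toComplex, Fin.sum_univ_two]

theorem area_eq_im (u v : Plane) :
    area u v = (starRingEnd ℂ (toComplex u) * toComplex v).im := by
  simp [area, toComplex, Complex.mul_im]; ring

theorem toComplex_eq (v : Plane) :
    toComplex v = ((v 0 : ℝ) : ℂ) + ((v 1 : ℝ) : ℂ) * Complex.I := by
  apply Complex.ext <;> simp [toComplex]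

theorem hasDerivAt_toComplex {f : ℝ → Plane} {f' : Plane} {t : ℝ} (hf : HasDerivAt f f' t) :
    HasDerivAt (fun t => toComplex (f t)) (toComplex f') t := by
  have hf := hasDerivAt_coord hf
  simp only [toComplex_eq]
  exact ((hf 0).ofReal_comp).add (((hf 1).ofReal_comp).mul_const _)

theorem continuous_toComplex : Continuous toComplex := by
  have : toComplex = fun v : Plane => ((v 0 : ℝ) : ℂ) + ((v 1 : ℝ) : ℂ) * Complex.I :=
    funext toComplex_eq
  rw [this]; fun_prop

namespace IsClosedConvexCurve

variable {γ : ℝ → Plane} {L : ℝ}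

theorem hasDerivAt (h : IsClosedConvexCurve γ L) (t : ℝ) : HasDerivAt γ (deriv γ t) t :=
  ((h.contDiff.differentiable (by norm_num)) t).hasDerivAt

theorem contDiff_deriv (h : IsClosedConvexCurve γ L) : ContDiff ℝ 1 (deriv γ) :=
  ((contDiff_succ_iff_deriv (n := 1)).1 (by simpa [one_add_one_eq_two] using h.contDiff)).2.2

theorem hasDerivAt_deriv (h : IsClosedConvexCurve γ L) (t : ℝ) :
    HasDerivAt (deriv γ) (deriv (deriv γ) t) t :=
  ((h.contDiff_deriv.differentiable (by norm_num)) t).hasDerivAt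

theorem continuous (h : IsClosedConvexCurve γ L) : Continuous γ := h.contDiff.continuous

theorem continuous_deriv (h : IsClosedConvexCurve γ L) : Continuous (deriv γ) :=
  h.contDiff_deriv.continuous

theorem continuous_deriv_deriv (h : IsClosedConvexCurve γ L) : Continuous (deriv (deriv γ)) :=
  h.contDiff_deriv.continuous_deriv le_rfl

theorem periodic_deriv (h : IsClosedConvexCurve γ L) : Function.Periodic (deriv γ) L := by
  intro t
  have := h.periodic
  have h1 : (fun s => γ (s + L)) = γ := funext this
  rw [← deriv_comp_add_const, h1]

theorem periodic_deriv_deriv (h : IsClosedConvexCurve γ L) :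
    Function.Periodic (deriv (deriv γ)) L := by
  intro t
  have h1 : (fun s => deriv γ (s + L)) = deriv γ := funext h.periodic_deriv
  rw [← deriv_comp_add_const, h1]

/-- Adding the convexity inequalities at `t` and `s` shows that the area of the difference quotients
of `γ` and `γ'` is nonnegative; then let `s` tend to `t`. -/
theorem area_deriv_deriv_nonneg (h : IsClosedConvexCurve γ L) (t : ℝ) :
    0 ≤ area (deriv γ t) (deriv (deriv γ) t) := by
  have h1 := hasDerivAt_iff_tendsto_slope.1 (h.hasDerivAt t)
  have h2 := hasDerivAt_iff_tendsto_slope.1 (h.hasDerivAt_deriv t)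
  have h3 := (continuous_area.tendsto (deriv γ t, deriv (deriv γ) t)).comp (h1.prodMk_nhds h2)
  refine ge_of_tendsto' h3 fun s => ?_
  simp only [Function.comp, slope, vsub_eq_sub, area_smul_left, area_smul_right]
  have e : area (γ s - γ t) (deriv γ s - deriv γ t) =
      area (deriv γ t) (γ s - γ t) + area (deriv γ s) (γ t - γ s) := by
    simp only [area, PiLp.sub_apply]; ring
  have := h.convex t s
  have := h.convex s t
  rw [← mul_assoc, e]
  have := mul_self_nonneg (s - t)⁻¹
  positivity

end IsClosedConvexCurve

/-! ### The tangent angle and the turning number. -/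

/-- `θ` is a continuous determination of the angle of the tangent of a convex curve. -/
structure IsTangentAngle (γ : ℝ → Plane) (L : ℝ) (θ : ℝ → ℝ) : Prop where
  continuous : Continuous θ
  monotone : Monotone θ
  add_period : ∀ t, θ (t + L) = θ t + 2 * Real.pi
  area_deriv : ∀ s t, area (deriv γ s) (deriv γ t) =
    ‖deriv γ s‖ * ‖deriv γ t‖ * Real.sin (θ t - θ s)
  deriv_eq : ∀ s t, Real.sin (θ t - θ s) = 0 →
    ‖deriv γ s‖ • deriv γ t = (‖deriv γ t‖ * Real.cos (θ t - θ s)) • deriv γ s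

/-- Existence of a tangent angle with an undetermined number of turns. -/
theorem IsClosedConvexCurve.exists_angle {γ : ℝ → Plane} {L : ℝ} (h : IsClosedConvexCurve γ L) :
    ∃ (θ : ℝ → ℝ) (k : ℤ), Continuous θ ∧ Monotone θ ∧
      (∀ t, θ (t + L) = θ t + k * (2 * Real.pi)) ∧
      ∀ t, toComplex (deriv γ t) = ‖deriv γ t‖ * Complex.exp (θ t * Complex.I) := by
  set w : ℝ → ℂ := fun t => toComplex (deriv γ t) with hw
  set w' : ℝ → ℂ := fun t => toComplex (deriv (deriv γ) t) with hw'
  have hw0 : ∀ t, w t ≠ 0 := fun t => toComplex_ne_zero (h.regular t)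
  have hwd : ∀ t, HasDerivAt w (w' t) t := fun t => hasDerivAt_toComplex (h.hasDerivAt_deriv t)
  have hq : Continuous fun t => w' t / w t :=
    (continuous_toComplex.comp h.continuous_deriv_deriv).div
      (continuous_toComplex.comp h.continuous_deriv) hw0
  obtain ⟨l0, hl0⟩ : ∃ l0, Complex.exp l0 = w 0 := ⟨Complex.log (w 0), Complex.exp_log (hw0 0)⟩
  -- A primitive of the logarithmic derivative is a global logarithm of the velocity; its imaginary
  -- part is the angle.
  set l : ℝ → ℂ := fun t => l0 + ∫ s in (0 : ℝ)..t, w' s / w s with hl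
  have hld : ∀ t, HasDerivAt l (w' t / w t) t := fun t =>
    (hq.integral_hasStrictDerivAt 0 t).hasDerivAt.const_add _
  have hexp : ∀ t, w t = Complex.exp (l t) := by
    have hd : ∀ t, HasDerivAt (fun t => w t * Complex.exp (-l t)) 0 t := fun t => by
      refine ((hwd t).mul ((hld t).neg.cexp)).congr_deriv ?_
      have := hw0 t
      field_simp
      ring
    intro t
    have := is_const_of_deriv_eq_zero (fun t => (hd t).differentiableAt) (fun t => (hd t).deriv) t 0
    have e0 : l 0 = l0 := by simp [hl]
    simp only [e0, ← hl0, Complex.exp_neg] at this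
    rw [mul_inv_cancel₀ (Complex.exp_ne_zero _)] at this
    have h2 := Complex.exp_ne_zero (l t)
    field_simp at this
    exact this
  have hdθ : ∀ t, HasDerivAt (fun t => (l t).im) (w' t / w t).im t := fun t =>
    (Complex.imCLM.hasFDerivAt.comp_hasDerivAt t (hld t))
  have hper : ∀ t, w (t + L) = w t := fun t => by simp only [hw, h.periodic_deriv t]
  have hper' : ∀ t, w' (t + L) = w' t := fun t => by simp only [hw', h.periodic_deriv_deriv t]
  have hconst : ∀ t, l (t + L) - l t = l (0 + L) - l 0 := by
    have hd : ∀ t, HasDerivAt (fun t => l (t + L) - l t) 0 t := fun t => by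
      refine (((hld (t + L)).comp_add_const t L).sub (hld t)).congr_deriv ?_
      rw [hper, hper', sub_self]
    intro t
    exact is_const_of_deriv_eq_zero (fun t => (hd t).differentiableAt) (fun t => (hd t).deriv) t 0
  have h1 : Complex.exp (l (0 + L)) = Complex.exp (l 0) := by rw [← hexp, ← hexp, hper]
  obtain ⟨k, hk⟩ := Complex.exp_eq_exp_iff_exists_int.1 h1
  refine ⟨fun t => (l t).im, k, ?_, ?_, fun t => ?_, fun t => ?_⟩
  · exact continuous_iff_continuousAt.2 fun t => (hdθ t).continuousAt
  · refine monotone_of_deriv_nonneg (fun t => (hdθ t).differentiableAt) fun t => ?_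
    rw [(hdθ t).deriv]
    -- The angular speed is the area of `γ'` and `γ''` over the squared speed, so convexity gives
    -- its sign.
    have e : w' t / w t = (starRingEnd ℂ (w t) * w' t) / (Complex.normSq (w t) : ℂ) := by
      rw [Complex.normSq_eq_conj_mul_self, mul_div_mul_left]
      exact (map_ne_zero _).2 (hw0 t)
    rw [e, Complex.div_ofReal_im]
    have h3 := h.area_deriv_deriv_nonneg t
    rw [area_eq_im] at h3
    exact div_nonneg h3 (Complex.normSq_nonneg _)
  · have h2 := hconst t
    rw [hk, add_sub_cancel_left, sub_eq_iff_eq_add] at h2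
    simp only [h2, Complex.add_im, Complex.mul_im]
    simp
    ring
  · have h2 := hexp t
    have h3 : ‖deriv γ t‖ = Real.exp (l t).re := by
      rw [← norm_toComplex, ← Complex.norm_exp, ← h2]
    change w t = _
    rw [h2, h3, Complex.ofReal_exp, ← Complex.exp_add]
    congr 1
    exact (Complex.re_add_im _).symm

theorem coord_of_toComplex {u : Plane} {a : ℝ}
    (hu : toComplex u = ‖u‖ * Complex.exp (a * Complex.I)) :
    u 0 = ‖u‖ * Real.cos a ∧ u 1 = ‖u‖ * Real.sin a := by
  simp only [Complex.exp_mul_I, ← Complex.ofReal_cos, ← Complex.ofReal_sin] at hu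
  have h1 := congrArg Complex.re hu
  have h2 := congrArg Complex.im hu
  simp [toComplex] at h1 h2
  exact ⟨h1, h2⟩

theorem area_eq_sin {u v : Plane} {a b : ℝ}
    (hu : toComplex u = ‖u‖ * Complex.exp (a * Complex.I))
    (hv : toComplex v = ‖v‖ * Complex.exp (b * Complex.I)) :
    area u v = ‖u‖ * ‖v‖ * Real.sin (b - a) := by
  obtain ⟨h1, h2⟩ := coord_of_toComplex hu
  obtain ⟨h3, h4⟩ := coord_of_toComplex hv
  rw [area, h1, h2, h3, h4, Real.sin_sub]
  ring

theorem smul_eq_of_sin_eq_zero {u v : Plane} {a b : ℝ}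
    (hu : toComplex u = ‖u‖ * Complex.exp (a * Complex.I))
    (hv : toComplex v = ‖v‖ * Complex.exp (b * Complex.I)) (h : Real.sin (b - a) = 0) :
    ‖u‖ • v = (‖v‖ * Real.cos (b - a)) • u := by
  obtain ⟨h1, h2⟩ := coord_of_toComplex hu
  obtain ⟨h3, h4⟩ := coord_of_toComplex hv
  have e1 : Real.cos b = Real.cos (b - a) * Real.cos a := by
    have := Real.cos_add (b - a) a
    rw [sub_add_cancel, h] at this; linarith
  have e2 : Real.sin b = Real.cos (b - a) * Real.sin a := by
    have := Real.sin_add (b - a) a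
    rw [sub_add_cancel, h] at this; linarith
  ext i
  fin_cases i
  · simp only [Fin.zero_eta, PiLp.smul_apply, smul_eq_mul]
    linear_combination ‖u‖ * h3 + ‖u‖ * ‖v‖ * e1 - ‖v‖ * Real.cos (b - a) * h1
  · simp only [Fin.mk_one, PiLp.smul_apply, smul_eq_mul]
    linear_combination ‖u‖ * h4 + ‖u‖ * ‖v‖ * e2 - ‖v‖ * Real.cos (b - a) * h2

/-- A regular point of a convex curve which lies strictly between two points of the curve in
direction `v` has its tangent in direction `v`. -/
theorem IsClosedConvexCurve.area_deriv_eq_zero_of_between {γ : ℝ → Plane} {L : ℝ}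
    (h : IsClosedConvexCurve γ L) {v : Plane} {m r s a b : ℝ} (ha : 0 < a) (hb : 0 < b)
    (hr : γ r - γ m = a • v) (hs : γ s - γ m = -b • v) : area (deriv γ m) v = 0 := by
  have h1 := h.convex m r
  have h2 := h.convex m s
  rw [hr, area_smul_right] at h1
  rw [hs, area_smul_right] at h2
  have h1 := nonneg_of_mul_nonneg_right h1 ha
  nlinarith

/-- Three different points of a convex curve on a line in direction `v`: at one of them the
tangent has direction `v`. -/
theorem IsClosedConvexCurve.exists_area_deriv_eq_zero {γ : ℝ → Plane} {L : ℝ}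
    (h : IsClosedConvexCurve γ L) {v : Plane} {r₁ r₂ r₃ a b : ℝ} (ha : a ≠ 0) (hb : b ≠ 0)
    (hab : a ≠ b) (h₂ : γ r₂ - γ r₁ = a • v) (h₃ : γ r₃ - γ r₁ = b • v) :
    area (deriv γ r₁) v = 0 ∨ area (deriv γ r₂) v = 0 ∨ area (deriv γ r₃) v = 0 := by
  have e21 : γ r₁ - γ r₂ = (-a) • v := by rw [neg_smul, ← h₂]; abel
  have e31 : γ r₁ - γ r₃ = (-b) • v := by rw [neg_smul, ← h₃]; abel
  have e23 : γ r₃ - γ r₂ = (b - a) • v := by rw [sub_smul, ← h₂, ← h₃]; abel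
  have e32 : γ r₂ - γ r₃ = (a - b) • v := by rw [sub_smul, ← h₂, ← h₃]; abel
  have key : ∀ {m r s c d : ℝ}, γ r - γ m = c • v → γ s - γ m = d • v → c * d < 0 →
      area (deriv γ m) v = 0 := by
    intro m r s c d h1 h2 hcd
    rcases mul_neg_iff.1 hcd with ⟨hc, hd⟩ | ⟨hc, hd⟩
    · exact h.area_deriv_eq_zero_of_between hc (neg_pos.2 hd) h1 (by rw [h2, neg_neg])
    · exact h.area_deriv_eq_zero_of_between hd (neg_pos.2 hc) h2 (by rw [h1, neg_neg])
  by_cases h1 : a * b < 0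
  · exact Or.inl (key h₂ h₃ h1)
  by_cases h2 : (-a) * (b - a) < 0
  · exact Or.inr (Or.inl (key e21 e23 h2))
  refine Or.inr (Or.inr (key e31 e32 ?_))
  rcases lt_or_gt_of_ne ha with ha | ha <;> rcases lt_or_gt_of_ne hb with hb | hb <;>
    rcases lt_or_gt_of_ne hab with hab | hab <;> nlinarith

/-- The tangent of a simple closed convex curve turns exactly once. -/
theorem IsClosedConvexCurve.exists_isTangentAngle {γ : ℝ → Plane} {L : ℝ}
    (h : IsClosedConvexCurve γ L) : ∃ θ, IsTangentAngle γ L θ := by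
  obtain ⟨θ, k, hc, hm, hk, hw⟩ := h.exists_angle
  have hL := h.period_pos
  have hsin : ∀ s t, area (deriv γ s) (deriv γ t) =
      ‖deriv γ s‖ * ‖deriv γ t‖ * Real.sin (θ t - θ s) := fun s t => area_eq_sin (hw s) (hw t)
  have hn : ∀ t, 0 < ‖deriv γ t‖ := fun t => norm_pos_iff.2 (h.regular t)
  have hd : ∀ r, HasDerivAt (fun r => area (deriv γ 0) (γ r)) (area (deriv γ 0) (deriv γ r)) r := by
    intro r
    refine (hasDerivAt_area (hasDerivAt_const r (deriv γ 0)) (h.hasDerivAt r)).congr_deriv ?_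
    simp [area]
  have hpi := Real.pi_pos
  have hk0 : 0 ≤ k := by
    have h1 : θ 0 ≤ θ (0 + L) := hm (by linarith)
    rw [hk] at h1
    by_contra hneg
    have : (k : ℝ) ≤ -1 := by exact_mod_cast (show k ≤ -1 by omega)
    nlinarith
  -- With no turn the direction is constant, and Rolle's theorem for the component along `γ' 0`
  -- contradicts periodicity.
  have hk1 : k ≠ 0 := by
    rintro rfl
    have hθ : ∀ r ∈ Icc (0 : ℝ) L, θ r = θ 0 := fun r hr => by
      have h1 := hm hr.1
      have h2 := hm hr.2
      have h3 := hk 0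
      simp at h3
      linarith
    set f : ℝ → ℝ := fun r => (deriv γ 0) 0 * (γ r) 0 + (deriv γ 0) 1 * (γ r) 1
    have hf : ∀ r, HasDerivAt f
        ((deriv γ 0) 0 * (deriv γ r) 0 + (deriv γ 0) 1 * (deriv γ r) 1) r := fun r =>
      ((hasDerivAt_coord (h.hasDerivAt r) 0).const_mul _).add
        ((hasDerivAt_coord (h.hasDerivAt r) 1).const_mul _)
    have hfL : f 0 = f L := by
      have := h.periodic 0
      rw [zero_add] at this
      simp only [f, this]
    obtain ⟨r, hr, h0⟩ := exists_hasDerivAt_eq_zero hL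
      (fun r _ => (hf r).continuousAt.continuousWithinAt) hfL fun r _ => hf r
    obtain ⟨c1, c2⟩ := coord_of_toComplex (hw 0)
    obtain ⟨c3, c4⟩ := coord_of_toComplex (hw r)
    rw [hθ r ⟨hr.1.le, hr.2.le⟩] at c3 c4
    rw [c1, c2, c3, c4] at h0
    have : ‖deriv γ 0‖ * ‖deriv γ r‖ = 0 := by
      linear_combination h0 - ‖deriv γ 0‖ * ‖deriv γ r‖ * Real.sin_sq_add_cos_sq (θ 0)
    exact absurd this (mul_pos (hn 0) (hn r)).ne'
  -- With two turns the height over `γ' 0` attains its minimum, maximum, minimum and maximum at the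
  -- angles `0, π, 2π, 3π`. An intermediate level is then met three times, giving three collinear
  -- points. Convexity makes the tangent at one of them parallel to `γ' 0`, so that point is
  -- extremal in height.
  have hk2 : k < 2 := by
    by_contra hk2
    have hk2 : (2 : ℝ) ≤ k := by exact_mod_cast not_lt.1 hk2
    have hθL : θ 0 + 4 * Real.pi ≤ θ L := by
      have := hk 0
      rw [zero_add] at this
      nlinarith
    have ivt : ∀ c, 0 ≤ c → c ≤ 4 * Real.pi → ∃ r ∈ Icc 0 L, θ r - θ 0 = c := by
      intro c h0 h4
      obtain ⟨r, hr, he⟩ := intermediate_value_Icc hL.le hc.continuousOn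
        (show θ 0 + c ∈ Icc (θ 0) (θ L) from ⟨by linarith, by linarith⟩)
      exact ⟨r, hr, by linarith⟩
    set H : ℝ → ℝ := fun r => area (deriv γ 0) (γ r) with hH
    have heven : ∀ m : ℤ, ∀ r, θ r - θ 0 = 2 * m * Real.pi → ∀ s, H r ≤ H s := by
      intro m r hr s
      have e : Real.cos (θ r - θ 0) = 1 := by
        rw [hr, ← Real.cos_int_mul_two_pi m]; ring_nf
      have h0 : Real.sin (θ r - θ 0) = 0 := by
        have := Real.sin_int_mul_pi (2 * m)
        push_cast at this
        rw [hr, this]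
      have h1 := smul_eq_of_sin_eq_zero (hw 0) (hw r) h0
      have h2 := mul_nonneg (hn 0).le (h.convex r s)
      rw [← area_smul_left, h1, e, mul_one, area_smul_left, area_sub_right] at h2
      have := nonneg_of_mul_nonneg_right h2 (hn r)
      simp only [hH]; linarith
    have hodd : ∀ m : ℤ, ∀ r, θ r - θ 0 = (2 * m + 1) * Real.pi → ∀ s, H s ≤ H r := by
      intro m r hr s
      have e : Real.cos (θ r - θ 0) = -1 := by
        rw [hr, ← Real.cos_int_mul_two_pi_add_pi m]; ring_nf
      have h0 : Real.sin (θ r - θ 0) = 0 := by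
        have := Real.sin_int_mul_pi (2 * m + 1)
        push_cast at this
        rw [hr, this]
      have h1 := smul_eq_of_sin_eq_zero (hw 0) (hw r) h0
      have h2 := mul_nonneg (hn 0).le (h.convex r s)
      rw [← area_smul_left, h1, e, area_smul_left, area_sub_right] at h2
      have := nonneg_of_mul_nonneg_right (show 0 ≤ ‖deriv γ r‖ * (H r - H s) by
        simp only [hH]; linarith) (hn r)
      linarith
    obtain ⟨rh, -, erh⟩ := ivt (Real.pi / 2) (by linarith) (by linarith)
    obtain ⟨r1, hr1, e1⟩ := ivt Real.pi (by linarith) (by linarith)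
    obtain ⟨r2, hr2, e2⟩ := ivt (2 * Real.pi) (by linarith) (by linarith)
    obtain ⟨r3, hr3, e3⟩ := ivt (3 * Real.pi) (by linarith) (by linarith)
    have hlt : ∀ {a b}, θ a < θ b → a < b := fun {a b} hab => hm.reflect_lt hab
    have l1 : (0 : ℝ) < r1 := hlt (by linarith)
    have l2 : r1 < r2 := hlt (by linarith)
    have l3 : r2 < r3 := hlt (by linarith)
    have m0 := heven 0 0 (by simp)
    have m1 := hodd 0 r1 (by simp [e1])
    have m2 := heven 1 r2 (by rw [e2]; push_cast; ring)
    have m3 := hodd 1 r3 (by rw [e3]; push_cast; ring)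
    have hpos : H 0 < H r1 := by
      by_contra hle
      have hcst : H = fun _ => H 0 := funext fun r => by linarith [m0 r, m1 r]
      have h1 := hd rh
      have h2 : HasDerivAt H 0 rh := by rw [hcst]; exact hasDerivAt_const _ _
      have h3 := h1.unique h2
      rw [hsin, erh, Real.sin_pi_div_two, mul_one] at h3
      exact absurd h3 (mul_pos (hn 0) (hn rh)).ne'
    have hHc : Continuous H := continuous_iff_continuousAt.2 fun r => (hd r).continuousAt
    have i2 : H r2 = H 0 := le_antisymm (m2 0) (m0 r2)
    have i3 : H r3 = H r1 := le_antisymm (m1 r3) (m3 r1)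
    set c := (H 0 + H r1) / 2 with hcdef
    obtain ⟨p1, hp1, q1⟩ := intermediate_value_Ioo l1.le hHc.continuousOn
      (show c ∈ Ioo (H 0) (H r1) from ⟨by linarith, by linarith⟩)
    obtain ⟨p2, hp2, q2⟩ := intermediate_value_Ioo' l2.le hHc.continuousOn
      (show c ∈ Ioo (H r2) (H r1) from ⟨by linarith, by linarith⟩)
    obtain ⟨p3, hp3, q3⟩ := intermediate_value_Ioo l3.le hHc.continuousOn
      (show c ∈ Ioo (H r2) (H r3) from ⟨by linarith, by linarith⟩)
    have hcrit : ∀ p, H p = c → area (deriv γ p) (deriv γ 0) ≠ 0 := by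
      intro p hp h0
      rw [area_swap, hsin, neg_eq_zero, mul_eq_zero] at h0
      rcases h0 with h0 | h0
      · exact absurd h0 (mul_pos (hn 0) (hn p)).ne'
      obtain ⟨j, hj⟩ := Real.sin_eq_zero_iff.1 h0
      rcases Int.even_or_odd' j with ⟨i, rfl | rfl⟩
      · push_cast at hj
        have := heven i p hj.symm 0
        linarith
      · push_cast at hj
        have := hodd i p hj.symm r1
        linarith
    have hr3L := hr3.2
    have hinj : ∀ p ∈ Ico 0 L, ∀ q ∈ Ico 0 L, p ≠ q → γ p ≠ γ q := fun p hp q hq hne he =>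
      hne (h.simple hp hq he)
    have hp1' : p1 ∈ Ico 0 L := ⟨hp1.1.le, by linarith [hp1.2]⟩
    have hp2' : p2 ∈ Ico 0 L := ⟨by linarith [hp2.1], by linarith [hp2.2]⟩
    have hp3' : p3 ∈ Ico 0 L := ⟨by linarith [hp3.1], by linarith [hp3.2]⟩
    have par : ∀ p q, H p = c → H q = c → ∃ a : ℝ, γ q - γ p = a • deriv γ 0 := by
      intro p q hp hq
      apply exists_smul_of_area_eq_zero (h.regular 0)
      rw [area_sub_right]
      simp only [hH] at hp hq
      linarith
    obtain ⟨a, ha⟩ := par p1 p2 q1 q2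
    obtain ⟨b, hb⟩ := par p1 p3 q1 q3
    have na : a ≠ 0 := by
      rintro rfl
      rw [zero_smul, sub_eq_zero] at ha
      exact hinj p2 hp2' p1 hp1' (by linarith [hp1.2, hp2.1]) ha
    have nb : b ≠ 0 := by
      rintro rfl
      rw [zero_smul, sub_eq_zero] at hb
      exact hinj p3 hp3' p1 hp1' (by linarith [hp1.2, hp3.1]) hb
    have nab : a ≠ b := by
      rintro rfl
      rw [← ha] at hb
      exact hinj p3 hp3' p2 hp2' (by linarith [hp2.2, hp3.1]) (sub_left_injective hb)
    rcases h.exists_area_deriv_eq_zero na nb nab ha hb with h0 | h0 | h0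
    · exact hcrit p1 q1 h0
    · exact hcrit p2 q2 h0
    · exact hcrit p3 q3 h0
  obtain rfl : k = 1 := by omega
  exact ⟨θ, hc, hm, fun t => by rw [hk]; simp, hsin,
    fun s t h0 => smul_eq_of_sin_eq_zero (hw s) (hw t) h0⟩

/-! ### The strip and the lifted billiard map. -/

/-- The universal cover of the phase annulus, in terms of a tangent angle. -/
def strip (θ : ℝ → ℝ) : Set (ℝ × ℝ) :=
  {p | 0 < θ p.2 - θ p.1 ∧ θ p.2 - θ p.1 < Real.pi}

/-- The height of the curve over its tangent direction at the parameter `y`. -/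
noncomputable def height (γ : ℝ → Plane) (y r : ℝ) : ℝ := area (deriv γ y) (γ r)

/-- `z` follows `x, y` in a lifted billiard orbit. -/
def IsNext (γ : ℝ → Plane) (θ : ℝ → ℝ) (x y z : ℝ) : Prop :=
  (x, y) ∈ strip θ ∧ (y, z) ∈ strip θ ∧ height γ y z = height γ y x

/-- The lift of the billiard map to the strip. -/
noncomputable def billiard (γ : ℝ → Plane) (θ : ℝ → ℝ) (p : ℝ × ℝ) : ℝ × ℝ :=
  (p.2, Classical.epsilon fun z => IsNext γ θ p.1 p.2 z)

theorem _root_.Function.Periodic.add_int_mul {α : Type*} {f : ℝ → α} {L : ℝ}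
    (hf : Function.Periodic f L) (t : ℝ) (j : ℤ) : f (t + j * L) = f t :=
  hf.int_mul j t

theorem IsClosedConvexCurve.eq_iff {γ : ℝ → Plane} {L : ℝ} (h : IsClosedConvexCurve γ L)
    {s t : ℝ} : γ s = γ t ↔ ∃ j : ℤ, s = t + j * L := by
  have hL := h.period_pos
  constructor
  · intro he
    have key : ∀ s, ∃ j : ℤ, s + j * L ∈ Ico 0 L := fun s => by
      obtain ⟨j, hj, -⟩ := existsUnique_add_zsmul_mem_Ico hL s 0
      exact ⟨j, by simpa using hj⟩
    obtain ⟨i, hi⟩ := key s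
    obtain ⟨j, hj⟩ := key t
    have := h.simple hi hj (by
      rw [h.periodic.add_int_mul, h.periodic.add_int_mul, he])
    refine ⟨j - i, ?_⟩
    push_cast
    linarith
  · rintro ⟨j, rfl⟩
    exact h.periodic.add_int_mul t j

theorem IsClosedConvexCurve.hasDerivAt_height {γ : ℝ → Plane} {L : ℝ}
    (h : IsClosedConvexCurve γ L) (y r : ℝ) :
    HasDerivAt (height γ y) (area (deriv γ y) (deriv γ r)) r := by
  refine (hasDerivAt_area (hasDerivAt_const r (deriv γ y)) (h.hasDerivAt r)).congr_deriv ?_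
  simp [area]

theorem IsClosedConvexCurve.continuous_height {γ : ℝ → Plane} {L : ℝ}
    (h : IsClosedConvexCurve γ L) : Continuous fun p : ℝ × ℝ => height γ p.1 p.2 :=
  continuous_area.comp ((h.continuous_deriv.comp continuous_fst).prodMk
    (h.continuous.comp continuous_snd))

theorem IsClosedConvexCurve.continuous_height_right {γ : ℝ → Plane} {L : ℝ}
    (h : IsClosedConvexCurve γ L) (y : ℝ) : Continuous (height γ y) :=
  h.continuous_height.comp (by fun_prop : Continuous fun r : ℝ => (y, r))

theorem IsClosedConvexCurve.height_add_int {γ : ℝ → Plane} {L : ℝ}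
    (h : IsClosedConvexCurve γ L) (y r : ℝ) (i j : ℤ) :
    height γ (y + i * L) (r + j * L) = height γ y r := by
  simp only [height, h.periodic_deriv.add_int_mul, h.periodic.add_int_mul]

theorem IsClosedConvexCurve.height_add_int_right {γ : ℝ → Plane} {L : ℝ}
    (h : IsClosedConvexCurve γ L) (y r : ℝ) (j : ℤ) :
    height γ y (r + j * L) = height γ y r := by
  simp only [height, h.periodic.add_int_mul]

namespace IsTangentAngle

variable {γ : ℝ → Plane} {L : ℝ} {θ : ℝ → ℝ}

theorem add_int (hθ : IsTangentAngle γ L θ) (t : ℝ) (j : ℤ) :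
    θ (t + j * L) = θ t + j * (2 * Real.pi) := by
  have hL : L ≠ 0 := by
    rintro rfl
    have h0 := hθ.add_period 0
    rw [add_zero] at h0
    linarith [Real.pi_pos]
  have hp : Function.Periodic (fun t => θ t - t * (2 * Real.pi) / L) L := fun t => by
    simp only [hθ.add_period]
    field_simp
    ring
  have := hp.add_int_mul t j
  field_simp at this
  refine mul_left_cancel₀ hL ?_
  linear_combination this

theorem lt_of_lt (hθ : IsTangentAngle γ L θ) {s t : ℝ} (h : θ s < θ t) : s < t :=
  hθ.monotone.reflect_lt h

theorem lt_of_mem (hθ : IsTangentAngle γ L θ) {s t : ℝ} (h : (s, t) ∈ strip θ) : s < t :=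
  hθ.lt_of_lt (by linarith [h.1])

theorem lt_add_of_mem (hθ : IsTangentAngle γ L θ) {s t : ℝ} (h : (s, t) ∈ strip θ) :
    t < s + L :=
  hθ.lt_of_lt (by rw [hθ.add_period]; linarith [h.2, Real.pi_pos])

theorem isOpen_strip (hθ : IsTangentAngle γ L θ) : IsOpen (strip θ) := by
  have h1 : Continuous fun p : ℝ × ℝ => θ p.2 - θ p.1 :=
    (hθ.continuous.comp continuous_snd).sub (hθ.continuous.comp continuous_fst)
  exact (isOpen_lt continuous_const h1).inter (isOpen_lt h1 continuous_const)

theorem add_int_mem (hθ : IsTangentAngle γ L θ) {s t : ℝ} (j : ℤ) :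
    (s + j * L, t + j * L) ∈ strip θ ↔ (s, t) ∈ strip θ := by
  simp only [strip, mem_ofPred_eq, hθ.add_int, add_sub_add_right_eq_sub]

theorem exists_angle_eq (hθ : IsTangentAngle γ L θ) (c : ℝ) : ∃ t, θ t = c := by
  have hpi := Real.pi_pos
  obtain ⟨n, hn⟩ := exists_int_gt ((c - θ 0) / (2 * Real.pi))
  obtain ⟨m, hm⟩ := exists_int_lt ((c - θ 0) / (2 * Real.pi))
  rw [div_lt_iff₀ (by positivity)] at hn
  rw [lt_div_iff₀ (by positivity)] at hm
  have e1 := hθ.add_int 0 n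
  have e2 := hθ.add_int 0 m
  exact mem_range_of_exists_le_of_exists_ge hθ.continuous ⟨_, (by rw [e2]; linarith)⟩
    ⟨_, (by rw [e1]; linarith)⟩

theorem mem_strip_of_between (hθ : IsTangentAngle γ L θ) {s t t' r : ℝ} (h : (s, t) ∈ strip θ)
    (h' : (s, t') ∈ strip θ) (h1 : t ≤ r) (h2 : r ≤ t') : (s, r) ∈ strip θ :=
  ⟨by linarith [h.1, hθ.monotone h1], by linarith [h'.2, hθ.monotone h2]⟩

theorem mem_strip_of_between_left (hθ : IsTangentAngle γ L θ) {s s' t r : ℝ}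
    (h : (s, t) ∈ strip θ) (h' : (s', t) ∈ strip θ) (h1 : s ≤ r) (h2 : r ≤ s') :
    (r, t) ∈ strip θ :=
  ⟨by linarith [h'.1, hθ.monotone h2], by linarith [h.2, hθ.monotone h1]⟩

theorem area_deriv_pos (h : IsClosedConvexCurve γ L) (hθ : IsTangentAngle γ L θ) {s t : ℝ}
    (hp : (s, t) ∈ strip θ) : 0 < area (deriv γ s) (deriv γ t) := by
  rw [hθ.area_deriv]
  have h1 := norm_pos_iff.2 (h.regular s)
  have h2 := norm_pos_iff.2 (h.regular t)
  have h3 := Real.sin_pos_of_pos_of_lt_pi hp.1 hp.2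
  positivity

/-- Pairs with positive area lift to the strip. -/
theorem exists_mem_strip (hθ : IsTangentAngle γ L θ) {s t : ℝ}
    (hp : 0 < area (deriv γ s) (deriv γ t)) : ∃ j : ℤ, (s, t + j * L) ∈ strip θ := by
  have hpi := Real.pi_pos
  obtain ⟨j, hj, -⟩ := existsUnique_add_zsmul_mem_Ico (show 0 < 2 * Real.pi by positivity)
    (θ t - θ s) 0
  rw [zsmul_eq_mul, zero_add] at hj
  refine ⟨j, ?_⟩
  rw [hθ.area_deriv, ← Real.sin_add_int_mul_two_pi _ j] at hp
  have hs := pos_of_mul_pos_right hp (by positivity)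
  have e : θ (t + j * L) - θ s = θ t - θ s + j * (2 * Real.pi) := by rw [hθ.add_int]; ring
  have h1 : θ t - θ s + j * (2 * Real.pi) ≠ 0 := fun h0 => by
    rw [h0, Real.sin_zero] at hs
    exact lt_irrefl _ hs
  have h2 : θ t - θ s + j * (2 * Real.pi) < Real.pi := by
    by_contra hle
    have := Real.sin_nonpos_of_nonpos_of_neg_pi_le
      (show θ t - θ s + j * (2 * Real.pi) - 2 * Real.pi ≤ 0 by linarith [hj.2])
      (by linarith)
    rw [Real.sin_sub_two_pi] at this
    linarith
  exact ⟨by rw [e]; exact lt_of_le_of_ne hj.1 (Ne.symm h1), by rw [e]; exact h2⟩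

/-- Where the tangent is parallel to that at `y` and has the same orientation, convexity at `z` is
the minimality of the height; the opposite orientation gives a maximum. -/
theorem height_min (h : IsClosedConvexCurve γ L) (hθ : IsTangentAngle γ L θ) {y z : ℝ}
    (h1 : θ z = θ y) (s : ℝ) : height γ y z ≤ height γ y s := by
  have h0 := hθ.deriv_eq y z (by simp [h1])
  have hy := norm_pos_iff.2 (h.regular y)
  have hz := norm_pos_iff.2 (h.regular z)
  have h2 := mul_nonneg hy.le (h.convex z s)
  rw [← area_smul_left, h0, h1, sub_self, Real.cos_zero, mul_one, area_smul_left,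
    area_sub_right] at h2
  have := nonneg_of_mul_nonneg_right h2 hz
  simp only [height]; linarith

theorem height_max (h : IsClosedConvexCurve γ L) (hθ : IsTangentAngle γ L θ) {y z : ℝ}
    (h1 : θ z = θ y + Real.pi ∨ θ z = θ y - Real.pi) (s : ℝ) :
    height γ y s ≤ height γ y z := by
  have hcs : Real.sin (θ z - θ y) = 0 ∧ Real.cos (θ z - θ y) = -1 := by
    rcases h1 with h1 | h1 <;> simp [h1]
  have h0 := hθ.deriv_eq y z hcs.1
  have hy := norm_pos_iff.2 (h.regular y)
  have hz := norm_pos_iff.2 (h.regular z)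
  have h2 := mul_nonneg hy.le (h.convex z s)
  rw [← area_smul_left, h0, hcs.2, area_smul_left, area_sub_right] at h2
  have := nonneg_of_mul_nonneg_right (show 0 ≤ ‖deriv γ z‖ * (height γ y z - height γ y s) by
    simp only [height]; linarith) hz
  linarith

/-- The derivative of the height is the area of the two velocities, which is positive on the strip.
This is the twist property. -/
theorem strictMonoOn_height (h : IsClosedConvexCurve γ L) (hθ : IsTangentAngle γ L θ) (y : ℝ) :
    StrictMonoOn (height γ y) {z | (y, z) ∈ strip θ} := by
  refine strictMonoOn_of_deriv_pos ?_ (h.continuous_height_right y).continuousOn fun z hz => ?_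
  · exact OrdConnected.convex ⟨fun a ha b hb c hc => hθ.mem_strip_of_between ha hb hc.1 hc.2⟩
  · rw [(h.hasDerivAt_height y z).deriv]
    have hz' := interior_subset hz
    exact area_deriv_pos h hθ hz'

theorem strictAntiOn_height (h : IsClosedConvexCurve γ L) (hθ : IsTangentAngle γ L θ) (y : ℝ) :
    StrictAntiOn (height γ y) {x | (x, y) ∈ strip θ} := by
  refine strictAntiOn_of_deriv_neg ?_ (h.continuous_height_right y).continuousOn fun z hz => ?_
  · exact OrdConnected.convex ⟨fun a ha b hb c hc => hθ.mem_strip_of_between_left ha hb hc.1 hc.2⟩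
  · rw [(h.hasDerivAt_height y z).deriv, area_swap]
    have hz' := interior_subset hz
    exact neg_neg_iff_pos.2 (area_deriv_pos h hθ hz')

/-- At a point of transversality the height is not extremal. -/
theorem height_lt_of_area_ne (h : IsClosedConvexCurve γ L) {y x : ℝ}
    (hA : area (deriv γ y) (deriv γ x) ≠ 0) :
    (∃ s, height γ y s < height γ y x) ∧ ∃ s, height γ y x < height γ y s := by
  constructor
  · by_contra hcon
    push Not at hcon
    exact hA (IsLocalMin.hasDerivAt_eq_zero (Eventually.of_forall hcon) (h.hasDerivAt_height y x))
  · by_contra hcon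
    push Not at hcon
    exact hA (IsLocalMax.hasDerivAt_eq_zero (Eventually.of_forall hcon) (h.hasDerivAt_height y x))

/-- Between the angles `θ y` and `θ y + π` the height runs from its minimum to its maximum. Since
`x` is transversal to `y`, its height is not extremal, so the intermediate value lies strictly
inside the strip. -/
theorem exists_next (h : IsClosedConvexCurve γ L) (hθ : IsTangentAngle γ L θ) {x y : ℝ}
    (hp : (x, y) ∈ strip θ) : ∃ z, IsNext γ θ x y z := by
  obtain ⟨f, hf⟩ := hθ.exists_angle_eq (θ y + Real.pi)
  have hpi := Real.pi_pos
  have hA : area (deriv γ y) (deriv γ x) ≠ 0 := by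
    rw [area_swap]; exact (neg_neg_iff_pos.2 (area_deriv_pos h hθ hp)).ne
  obtain ⟨⟨s, hs⟩, s', hs'⟩ := height_lt_of_area_ne h hA
  have hyf : y < f := hθ.lt_of_lt (by linarith)
  obtain ⟨z, hz, he⟩ := intermediate_value_Icc hyf.le (h.continuous_height_right y).continuousOn
    (show height γ y x ∈ Icc (height γ y y) (height γ y f) from
      ⟨height_min h hθ rfl x, height_max h hθ (Or.inl hf) x⟩)
  have m1 := hθ.monotone hz.1
  have m2 := hθ.monotone hz.2
  refine ⟨z, hp, ⟨?_, ?_⟩, he⟩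
  · refine sub_pos.2 (lt_of_le_of_ne m1 fun h0 => ?_)
    have := height_min h hθ h0.symm s
    linarith
  · refine sub_lt_iff_lt_add'.2 (lt_of_le_of_ne (by linarith) fun h0 => ?_)
    have := height_max h hθ (Or.inl h0) s'
    linarith

theorem exists_prev (h : IsClosedConvexCurve γ L) (hθ : IsTangentAngle γ L θ) {y z : ℝ}
    (hp : (y, z) ∈ strip θ) : ∃ x, IsNext γ θ x y z := by
  obtain ⟨f, hf⟩ := hθ.exists_angle_eq (θ y - Real.pi)
  have hpi := Real.pi_pos
  have hA := (area_deriv_pos h hθ hp).ne'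
  obtain ⟨⟨s, hs⟩, s', hs'⟩ := height_lt_of_area_ne h hA
  have hyf : f < y := hθ.lt_of_lt (by linarith)
  obtain ⟨x, hx, he⟩ := intermediate_value_Icc' hyf.le (h.continuous_height_right y).continuousOn
    (show height γ y z ∈ Icc (height γ y y) (height γ y f) from
      ⟨height_min h hθ rfl z, height_max h hθ (Or.inr hf) z⟩)
  have m1 := hθ.monotone hx.1
  have m2 := hθ.monotone hx.2
  refine ⟨x, ⟨?_, ?_⟩, hp, he.symm⟩
  · refine sub_pos.2 (lt_of_le_of_ne m2 fun h0 => ?_)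
    have := height_min h hθ h0 s
    linarith
  · refine sub_lt_comm.1 (lt_of_le_of_ne (by linarith) fun h0 => ?_)
    have := height_max h hθ (Or.inr h0.symm) s'
    linarith

/-- Height decreases before `y` and increases after it, so points at equal heights are ordered
oppositely on the two sides. -/
theorem lt_iff_of_isNext (h : IsClosedConvexCurve γ L) (hθ : IsTangentAngle γ L θ)
    {x x' y z z' : ℝ} (h1 : IsNext γ θ x y z) (h2 : IsNext γ θ x' y z') : x < x' ↔ z' < z := by
  rw [← (strictAntiOn_height h hθ y).lt_iff_gt h2.1 h1.1,
    ← (strictMonoOn_height h hθ y).lt_iff_lt h2.2.1 h1.2.1, h1.2.2, h2.2.2]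

theorem le_iff_of_isNext (h : IsClosedConvexCurve γ L) (hθ : IsTangentAngle γ L θ)
    {x x' y z z' : ℝ} (h1 : IsNext γ θ x y z) (h2 : IsNext γ θ x' y z') : x ≤ x' ↔ z' ≤ z := by
  rw [← not_lt, ← not_lt, lt_iff_of_isNext h hθ h2 h1]

theorem eq_iff_of_isNext (h : IsClosedConvexCurve γ L) (hθ : IsTangentAngle γ L θ)
    {x x' y z z' : ℝ} (h1 : IsNext γ θ x y z) (h2 : IsNext γ θ x' y z') : x = x' ↔ z = z' := by
  rw [le_antisymm_iff, le_iff_of_isNext h hθ h1 h2, le_iff_of_isNext h hθ h2 h1, and_comm,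
    ← le_antisymm_iff]

theorem isNext_billiard (h : IsClosedConvexCurve γ L) (hθ : IsTangentAngle γ L θ) {p : ℝ × ℝ}
    (hp : p ∈ strip θ) : IsNext γ θ p.1 p.2 (billiard γ θ p).2 :=
  Classical.epsilon_spec (exists_next h hθ hp)

theorem billiard_mem (h : IsClosedConvexCurve γ L) (hθ : IsTangentAngle γ L θ) {p : ℝ × ℝ}
    (hp : p ∈ strip θ) : billiard γ θ p ∈ strip θ :=
  (isNext_billiard h hθ hp).2.1

theorem isNext_iff (h : IsClosedConvexCurve γ L) (hθ : IsTangentAngle γ L θ) {x y z : ℝ} :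
    IsNext γ θ x y z ↔ (x, y) ∈ strip θ ∧ billiard γ θ (x, y) = (y, z) := by
  constructor
  · intro hn
    refine ⟨hn.1, Prod.ext rfl ?_⟩
    exact (eq_iff_of_isNext h hθ (isNext_billiard h hθ hn.1) hn).1 rfl
  · rintro ⟨h1, h2⟩
    have := isNext_billiard h hθ h1
    rwa [h2] at this

theorem injOn_billiard (h : IsClosedConvexCurve γ L) (hθ : IsTangentAngle γ L θ) :
    InjOn (billiard γ θ) (strip θ) := by
  rintro ⟨x, y⟩ hp ⟨x', y'⟩ hq he
  obtain rfl : y = y' := congrArg Prod.fst he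
  have h1 := isNext_billiard h hθ hp
  have h2 := isNext_billiard h hθ hq
  rw [he] at h1
  exact Prod.ext ((eq_iff_of_isNext h hθ h1 h2).2 rfl) rfl

theorem surjOn_billiard (h : IsClosedConvexCurve γ L) (hθ : IsTangentAngle γ L θ) :
    SurjOn (billiard γ θ) (strip θ) (strip θ) := by
  rintro ⟨y, z⟩ hp
  obtain ⟨x, hx⟩ := exists_prev h hθ hp
  exact ⟨(x, y), ((isNext_iff h hθ).1 hx).1, ((isNext_iff h hθ).1 hx).2⟩

theorem isNext_add_int (h : IsClosedConvexCurve γ L) (hθ : IsTangentAngle γ L θ)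
    {x y z : ℝ} (hn : IsNext γ θ x y z) (j : ℤ) :
    IsNext γ θ (x + j * L) (y + j * L) (z + j * L) :=
  ⟨(hθ.add_int_mem j).2 hn.1, (hθ.add_int_mem j).2 hn.2.1, by
    rw [h.height_add_int, h.height_add_int, hn.2.2]⟩

theorem billiard_add_int (h : IsClosedConvexCurve γ L) (hθ : IsTangentAngle γ L θ) {x y : ℝ}
    (hp : (x, y) ∈ strip θ) (j : ℤ) :
    billiard γ θ (x + j * L, y + j * L) =
      ((billiard γ θ (x, y)).1 + j * L, (billiard γ θ (x, y)).2 + j * L) :=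
  ((isNext_iff h hθ).1 (isNext_add_int h hθ (isNext_billiard h hθ hp) j)).2

/-- No implicit function theorem is needed: the strict height inequalities at `z ± η` persist for
nearby `q` and trap the image. -/
theorem continuousOn_billiard (h : IsClosedConvexCurve γ L) (hθ : IsTangentAngle γ L θ) :
    ContinuousOn (billiard γ θ) (strip θ) := by
  intro p hp
  apply ContinuousAt.continuousWithinAt
  refine ContinuousAt.prodMk continuousAt_snd ?_
  set z := (billiard γ θ p).2 with hz
  have hn := isNext_billiard h hθ hp
  rw [Metric.continuousAt_iff']
  intro ε hε
  have hopen : IsOpen {r : ℝ | (p.2, r) ∈ strip θ} :=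
    hθ.isOpen_strip.preimage (by fun_prop : Continuous fun r : ℝ => (p.2, r))
  obtain ⟨δ, hδ, hball⟩ := Metric.isOpen_iff.1 hopen z hn.2.1
  set η := min ε δ / 2 with hη
  have hη0 : 0 < η := by positivity
  have hηε : η < ε := by have := min_le_left ε δ; have := lt_min hε hδ; linarith
  have hηδ : η < δ := by have := min_le_right ε δ; have := lt_min hε hδ; linarith
  have mp : (p.2, z + η) ∈ strip θ := hball (by simp [Real.ball_eq_Ioo, hηδ]; linarith)
  have mm : (p.2, z - η) ∈ strip θ := hball (by simp [Real.ball_eq_Ioo, hηδ]; linarith)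
  have lp := strictMonoOn_height h hθ p.2 hn.2.1 mp (by linarith)
  have lm := strictMonoOn_height h hθ p.2 mm hn.2.1 (by linarith)
  rw [← hz, hn.2.2] at lp lm
  have cst : ∀ c : ℝ, Continuous fun q : ℝ × ℝ => (q.2, c) := fun c => by fun_prop
  have cx : Continuous fun q : ℝ × ℝ => height γ q.2 q.1 :=
    h.continuous_height.comp (by fun_prop : Continuous fun q : ℝ × ℝ => (q.2, q.1))
  have ev1 := (hθ.isOpen_strip.preimage (cst (z + η))).mem_nhds mp
  have ev2 := (hθ.isOpen_strip.preimage (cst (z - η))).mem_nhds mm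
  have ev3 := (isOpen_lt cx (h.continuous_height.comp (cst (z + η)))).mem_nhds
    (show p ∈ _ from lp)
  have ev4 := (isOpen_lt (h.continuous_height.comp (cst (z - η))) cx).mem_nhds
    (show p ∈ _ from lm)
  filter_upwards [ev1, ev2, ev3, ev4, hθ.isOpen_strip.mem_nhds hp] with q q1 q2 q3 q4 q5
  have hq := isNext_billiard h hθ q5
  simp only [Function.comp] at q3 q4
  rw [← hq.2.2] at q3 q4
  have r1 := ((strictMonoOn_height h hθ q.2).lt_iff_lt hq.2.1 q1).1 q3
  have r2 := ((strictMonoOn_height h hθ q.2).lt_iff_lt q2 hq.2.1).1 q4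
  rw [Real.dist_eq, abs_lt]
  constructor
  · change -ε < (billiard γ θ q).2 - z
    linarith
  · change (billiard γ θ q).2 - z < ε
    linarith

/-- The billiard relation on the phase space is the projection of the lifted map. -/
theorem eq_of_billiardStep (h : IsClosedConvexCurve γ L) (hθ : IsTangentAngle γ L θ) {x y : ℝ}
    (hp : (x, y) ∈ strip θ) {q : Plane × Plane} (hq : q ∈ phaseSpace γ)
    (hstep : BilliardStep γ (γ x, γ y) q) :
    q = (γ (billiard γ θ (x, y)).1, γ (billiard γ θ (x, y)).2) := by
  obtain ⟨s, t, hs, ht, hA⟩ := hq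
  obtain ⟨h1, -, -, u, hu, a, ha⟩ := hstep
  obtain ⟨j, hj⟩ := h.eq_iff.1 (show γ s = γ y from hs.trans h1)
  obtain ⟨i, hi⟩ := h.eq_iff.1 hu
  rw [hj, h.periodic_deriv.add_int_mul] at hA
  obtain ⟨k, hk⟩ := exists_mem_strip hθ hA
  have hn : IsNext γ θ x y (t + k * L) := by
    refine ⟨hp, hk, ?_⟩
    rw [h.height_add_int_right]
    rw [← ht, hi, h.periodic_deriv.add_int_mul] at ha
    have := area_smul_right (deriv γ y) (deriv γ y) a
    rw [← ha, area_self, mul_zero, area_sub_right] at this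
    simp only [height]
    linarith
  rw [((isNext_iff h hθ).1 hn).2]
  refine Prod.ext h1 ?_
  simp only [h.periodic.add_int_mul, ht]

end IsTangentAngle

/-! ### Lifting circles from the phase annulus to the strip. -/

/-- The points of the strip which project to points of `K`. -/
def liftedSet (γ : ℝ → Plane) (θ : ℝ → ℝ) (K : Set (Plane × Plane)) : Set (ℝ × ℝ) :=
  {p | p ∈ strip θ ∧ (γ p.1, γ p.2) ∈ K}

theorem eq_of_forall_exists_int_mul {f : ℝ → ℝ} (hf : Continuous f) {L : ℝ} (hL : L ≠ 0)
    (h : ∀ x, ∃ j : ℤ, f x = j * L) (x y : ℝ) : f x = f y := by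
  choose g hg using h
  have e : (fun x => ((g x : ℤ) : ℝ)) = fun x => f x / L := by
    funext x
    rw [hg x, mul_div_cancel_right₀ _ hL]
  have hgc : Continuous g := by
    rw [Int.isClosedEmbedding_coe_real.isEmbedding.continuous_iff]
    change Continuous fun x => ((g x : ℤ) : ℝ)
    rw [e]
    exact hf.div_const L
  rw [hg x, hg y, PreconnectedSpace.constant inferInstance hgc]

/-- A continuous injective self-map of the circle is onto. -/
theorem surjective_of_injective_circle {f : Circle → Circle} (hf : Continuous f)
    (hinj : Function.Injective f) : Function.Surjective f := by
  intro a
  by_contra hcon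
  push Not at hcon
  -- Rotation by `b` moves the omitted value `a` to `-1`, so the principal argument is continuous on
  -- the image.
  set b : Circle := Circle.exp Real.pi * a⁻¹ with hb
  have hslit : ∀ u, ((b * f u : Circle) : ℂ) ∈ Complex.slitPlane := fun u => by
    rw [Complex.mem_slitPlane_iff_arg]
    refine ⟨fun h0 => hcon u ?_, Circle.coe_ne_zero _⟩
    have h1 := Circle.exp_arg (b * f u)
    rw [h0, hb, mul_assoc, left_eq_mul, inv_mul_eq_one] at h1
    exact h1.symm
  set g : Circle → ℝ := fun u => ((b * f u : Circle) : ℂ).arg with hg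
  have hgc : Continuous g := continuous_iff_continuousAt.2 fun u =>
    (Complex.continuousAt_arg (hslit u)).comp
      (f := fun u => ((b * f u : Circle) : ℂ))
      (by fun_prop : Continuous fun u => ((b * f u : Circle) : ℂ)).continuousAt
  have hginj : Function.Injective g := fun u v huv =>
    hinj (mul_left_cancel (Circle.injective_arg huv))
  set e := Circle.exp Real.pi with he
  have hee : e * e = 1 := by
    rw [he, ← Circle.exp_add, ← two_mul, Circle.exp_two_pi]
  have he1 : e ≠ 1 := by
    intro h1
    have h2 := Circle.arg_exp (x := Real.pi) (by linarith [Real.pi_pos]) le_rfl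
    rw [← he, h1] at h2
    simp at h2
    exact Real.pi_ne_zero h2.symm
  -- One-dimensional Borsuk–Ulam: `d` changes sign under the antipodal map, so the injective real
  -- function `g` would agree at two antipodal points.
  set d : Circle → ℝ := fun u => g u - g (e * u) with hd
  have hdc : Continuous d := hgc.sub (hgc.comp (continuous_const.mul continuous_id))
  have hdodd : d e = -d 1 := by
    simp only [hd, hee, mul_one]; ring
  have hcs : ConnectedSpace Circle := by
    have : IsConnected (range Circle.exp) := isConnected_range Circle.exp.continuous
    rw [Circle.exp_surjective.range_eq] at this
    exact connectedSpace_iff_univ.2 this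
  obtain ⟨u, hu⟩ : ∃ u, d u = 0 := by
    rcases le_total (d 1) 0 with h1 | h1
    · exact mem_range_of_exists_le_of_exists_ge hdc ⟨1, h1⟩ ⟨e, by linarith⟩
    · exact mem_range_of_exists_le_of_exists_ge hdc ⟨e, by linarith⟩ ⟨1, h1⟩
  exact he1 (right_eq_mul.1 (hginj (sub_eq_zero.1 hu)))

namespace IsTangentAngle

variable {γ : ℝ → Plane} {L : ℝ} {θ : ℝ → ℝ}

/-- The projection of the strip to the phase space. -/
def proj (h : IsClosedConvexCurve γ L) (hθ : IsTangentAngle γ L θ) :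
    C(strip θ, phaseSpace γ) where
  toFun p := ⟨(γ p.1.1, γ p.1.2), p.1.1, p.1.2, rfl, rfl, area_deriv_pos h hθ p.2⟩
  continuous_toFun := by
    have := h.continuous
    fun_prop

/-- The vertical fibres are intervals and a locally constant choice works, so local choices can be
glued convexly. -/
theorem exists_section (hθ : IsTangentAngle γ L θ) :
    ∃ m : C(ℝ, ℝ), ∀ s, (s, m s) ∈ strip θ := by
  refine exists_continuous_forall_mem_convex_of_local_const (t := fun s => {r | (s, r) ∈ strip θ})
    (fun s => ?_) fun s => ?_
  · exact OrdConnected.convex ⟨fun a ha b hb c hc => hθ.mem_strip_of_between ha hb hc.1 hc.2⟩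
  · obtain ⟨c, hc⟩ := hθ.exists_angle_eq (θ s + Real.pi / 2)
    have hpi := Real.pi_pos
    refine ⟨c, ((hθ.isOpen_strip.preimage
      (by fun_prop : Continuous fun r : ℝ => (r, c))).mem_nhds ?_)⟩
    exact ⟨by simp only [hc]; linarith, by simp only [hc]; linarith⟩

theorem contractibleSpace_strip (hθ : IsTangentAngle γ L θ) : ContractibleSpace (strip θ) := by
  obtain ⟨m, hm⟩ := hθ.exists_section
  rw [contractible_iff_id_nullhomotopic]
  refine ⟨⟨(0, m 0), hm 0⟩, ?_⟩
  let r : C(strip θ, strip θ) :=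
    ⟨fun p => ⟨(p.1.1, m p.1.1), hm _⟩, by fun_prop⟩
  have h1 : (ContinuousMap.id (strip θ)).Homotopic r := by
    refine ⟨ContinuousMap.Homotopy.mk
      ⟨fun q => ⟨(q.2.1.1, (1 - q.1.1) * q.2.1.2 + q.1.1 * m q.2.1.1), ?_⟩, ?_⟩ ?_ ?_⟩
    · obtain ⟨⟨a, ha⟩, ⟨⟨s, t⟩, hp⟩⟩ := q
      have h0 := ha.1
      have h1 := ha.2
      simp only
      rcases le_total t (m s) with hl | hl
      · exact hθ.mem_strip_of_between hp (hm s) (by nlinarith) (by nlinarith)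
      · exact hθ.mem_strip_of_between (hm s) hp (by nlinarith) (by nlinarith)
    · fun_prop
    · intro p; apply Subtype.ext; simp
    · intro p; apply Subtype.ext; simp [r]
  have h2 : r.Homotopic (ContinuousMap.const _ ⟨(0, m 0), hm 0⟩) := by
    refine ⟨ContinuousMap.Homotopy.mk
      ⟨fun q => ⟨((1 - q.1.1) * q.2.1.1, m ((1 - q.1.1) * q.2.1.1)), hm _⟩, ?_⟩ ?_ ?_⟩
    · fun_prop
    · intro p; apply Subtype.ext; simp [r]
    · intro p; apply Subtype.ext; simp
  exact h1.trans h2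

theorem nullhomotopic_of_lift (h : IsClosedConvexCurve γ L) (hθ : IsTangentAngle γ L θ)
    (c : C(Circle, phaseSpace γ)) {s t : Circle → ℝ} (hs : Continuous s) (ht : Continuous t)
    (hst : ∀ u, (s u, t u) ∈ strip θ) (hc : ∀ u, (c u).1 = (γ (s u), γ (t u))) :
    c.Nullhomotopic := by
  have := hθ.contractibleSpace_strip
  let l : C(Circle, strip θ) := ⟨fun u => ⟨(s u, t u), hst u⟩, by fun_prop⟩
  have e : c = (proj h hθ).comp l := ContinuousMap.ext fun u => Subtype.ext (hc u)
  rw [e]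
  exact ((id_nullhomotopic (strip θ)).comp_left l).comp_right (proj h hθ)

theorem exists_lift (h : IsClosedConvexCurve γ L) (hθ : IsTangentAngle γ L θ)
    (c : C(Circle, phaseSpace γ)) : ∃ s t : ℝ → ℝ, Continuous s ∧ Continuous t ∧
      (∀ τ, (s τ, t τ) ∈ strip θ) ∧ ∀ τ, (c (Circle.exp τ)).1 = (γ (s τ), γ (t τ)) := by
  have hL := h.period_pos
  have : Fact (0 < L) := ⟨hL⟩
  let g : AddCircle L → Plane := h.periodic.lift
  have hgc : Continuous g := h.continuous.quotient_lift _
  have hg : ∀ r : ℝ, g (r : AddCircle L) = γ r := fun r => h.periodic.lift_coe r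
  have hginj : Function.Injective g := by
    intro a b
    induction a using QuotientAddGroup.induction_on with | _ a
    induction b using QuotientAddGroup.induction_on with | _ b
    intro hab
    rw [hg, hg] at hab
    obtain ⟨j, rfl⟩ := h.eq_iff.1 hab
    simp [← zsmul_eq_mul]
  have hemb := (hgc.isClosedEmbedding hginj).isEmbedding
  have hex : ∀ u : Circle, ∃ a b : AddCircle L, g a = (c u).1.1 ∧ g b = (c u).1.2 := by
    intro u
    obtain ⟨s, t, hs, ht, -⟩ := (c u).2
    exact ⟨s, t, (hg s).trans hs, (hg t).trans ht⟩
  choose x y hx hy using hex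
  have hxc : Continuous x := hemb.continuous_iff.2 (by
    have : g ∘ x = fun u => (c u).1.1 := funext hx
    rw [this]; fun_prop)
  have hyc : Continuous y := hemb.continuous_iff.2 (by
    have : g ∘ y = fun u => (c u).1.2 := funext hy
    rw [this]; fun_prop)
  obtain ⟨s0, hs0⟩ := QuotientAddGroup.mk_surjective (x (Circle.exp 0))
  obtain ⟨s, ⟨-, hs⟩, -⟩ := (AddCircle.isCoveringMap_coe L).existsUnique_continuousMap_lifts
    (⟨fun τ => x (Circle.exp τ), by fun_prop⟩ : C(ℝ, AddCircle L)) 0 s0 hs0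
  have hs : ∀ τ, ((s τ : ℝ) : AddCircle L) = x (Circle.exp τ) := fun τ => congrFun hs τ
  have hne : ∀ u, y u - x u ≠ 0 := by
    intro u h0
    obtain ⟨a, b, ha, hb, hA⟩ := (c u).2
    obtain ⟨j, rfl⟩ := h.eq_iff.1 (show γ a = γ b by
      rw [ha, hb, ← hx, ← hy, sub_eq_zero.1 h0])
    rw [h.periodic_deriv.add_int_mul, area_self] at hA
    exact lt_irrefl _ hA
  let φ := AddCircle.openPartialHomeomorphCoe L (0 : ℝ)
  have hmem : ∀ u, y u - x u ∈ φ.target := fun u => by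
    simpa [φ] using hne u
  -- Only `x` is lifted by the covering. The difference `y - x` never vanishes, so it has a
  -- continuous representative in `(0, L)`.
  let t : ℝ → ℝ := fun τ => s τ + φ.symm (y (Circle.exp τ) - x (Circle.exp τ))
  have htc : Continuous t := by
    refine s.continuous.add (φ.continuousOn_symm.comp_continuous ?_ fun τ => hmem _)
    fun_prop
  have ht : ∀ τ, ((t τ : ℝ) : AddCircle L) = y (Circle.exp τ) := fun τ => by
    have h1 : ((φ.symm (y (Circle.exp τ) - x (Circle.exp τ)) : ℝ) : AddCircle L) =
      y (Circle.exp τ) - x (Circle.exp τ) := φ.right_inv (hmem _)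
    simp only [t, AddCircle.coe_add, h1, hs]
    abel
  have e1 : ∀ τ, γ (s τ) = (c (Circle.exp τ)).1.1 := fun τ => by rw [← hg, hs, hx]
  have e2 : ∀ τ, γ (t τ) = (c (Circle.exp τ)).1.2 := fun τ => by rw [← hg, ht, hy]
  refine ⟨s, t, s.continuous, htc, fun τ => ?_, fun τ => Prod.ext (e1 τ).symm (e2 τ).symm⟩
  obtain ⟨a, b, ha, hb, hA⟩ := (c (Circle.exp τ)).2
  rw [← e1] at ha
  rw [← e2] at hb
  obtain ⟨i, rfl⟩ := h.eq_iff.1 ha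
  obtain ⟨j, rfl⟩ := h.eq_iff.1 hb
  rw [h.periodic_deriv.add_int_mul, h.periodic_deriv.add_int_mul] at hA
  have hr : φ.symm (y (Circle.exp τ) - x (Circle.exp τ)) ∈ Ioo (0 : ℝ) (0 + L) :=
    φ.map_target (hmem _)
  have h1 : s τ ≤ t τ := by simp only [t]; linarith [hr.1]
  have h2 : t τ ≤ s τ + L := by simp only [t]; linarith [hr.2]
  have h3 := hθ.monotone h1
  have h4 := hθ.monotone h2
  rw [hθ.add_period] at h4
  rw [hθ.area_deriv] at hA
  have hsin := pos_of_mul_pos_right hA (by positivity)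
  have h5 : θ (t τ) ≠ θ (s τ) := fun h0 => by simp [h0] at hsin
  refine ⟨sub_pos.2 (lt_of_le_of_ne h3 h5.symm), ?_⟩
  by_contra hle
  have := Real.sin_nonpos_of_nonpos_of_neg_pi_le
    (show θ (t τ) - θ (s τ) - 2 * Real.pi ≤ 0 by linarith) (by simp only at hle; linarith)
  rw [Real.sin_sub_two_pi] at this
  linarith

/-- Both angle gaps lie in `(0, π)`, while shifts by different numbers of periods would change the
gap by at least `2π`; so the deck group is the diagonal one. -/
theorem eq_add_int_of_proj_eq (h : IsClosedConvexCurve γ L) (hθ : IsTangentAngle γ L θ)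
    {s t s' t' : ℝ} (hp : (s, t) ∈ strip θ) (hp' : (s', t') ∈ strip θ) (hs : γ s' = γ s)
    (ht : γ t' = γ t) : ∃ j : ℤ, s' = s + j * L ∧ t' = t + j * L := by
  obtain ⟨i, rfl⟩ := h.eq_iff.1 hs
  obtain ⟨j, rfl⟩ := h.eq_iff.1 ht
  suffices i = j by subst this; exact ⟨i, rfl, rfl⟩
  obtain ⟨h1, h2⟩ := hp
  obtain ⟨h3, h4⟩ := hp'
  simp only [hθ.add_int] at h1 h2 h3 h4
  have hpi := Real.pi_pos
  have a1 : ((j : ℝ) - i) < 1 := by nlinarith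
  have a2 : (-1 : ℝ) < (j : ℝ) - i := by nlinarith
  have b1 : j - i < 1 := by exact_mod_cast a1
  have b2 : -1 < j - i := by exact_mod_cast a2
  omega

/-- An essential circle has an unbounded periodic lift to the strip. -/
theorem exists_periodic_lift (h : IsClosedConvexCurve γ L) (hθ : IsTangentAngle γ L θ)
    (c : C(Circle, phaseSpace γ)) (hc : ¬ c.Nullhomotopic) :
    ∃ (s t : ℝ → ℝ) (n : ℤ), 0 < n ∧ Continuous s ∧ Continuous t ∧
      (∀ τ, (s τ, t τ) ∈ strip θ) ∧
      (∀ τ, s (τ + 2 * Real.pi) = s τ + n * L ∧ t (τ + 2 * Real.pi) = t τ + n * L) ∧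
      (∀ τ, ∃ u, (c u).1 = (γ (s τ), γ (t τ))) ∧ ∀ u, ∃ τ, (c u).1 = (γ (s τ), γ (t τ)) := by
  obtain ⟨s, t, hs, ht, hst, hcst⟩ := exists_lift h hθ c
  have hL := h.period_pos
  have hj : ∀ τ, ∃ j : ℤ, s (τ + 2 * Real.pi) = s τ + j * L ∧ t (τ + 2 * Real.pi) = t τ + j * L := by
    intro τ
    have e : (γ (s (τ + 2 * Real.pi)), γ (t (τ + 2 * Real.pi))) = (γ (s τ), γ (t τ)) := by
      rw [← hcst, ← hcst, Circle.exp_add_two_pi]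
    exact eq_add_int_of_proj_eq h hθ (hst τ) (hst _) (congrArg Prod.fst e) (congrArg Prod.snd e)
  choose j hj1 hj2 using hj
  have hconst : ∀ τ, j τ = j 0 := fun τ => by
    have := eq_of_forall_exists_int_mul (f := fun τ => s (τ + 2 * Real.pi) - s τ)
      (by fun_prop) hL.ne' (fun τ => ⟨j τ, by rw [hj1]; ring⟩) τ 0
    simp only [hj1, add_sub_cancel_left] at this
    exact_mod_cast mul_right_cancel₀ hL.ne' this
  have hper : ∀ τ, s (τ + 2 * Real.pi) = s τ + j 0 * L ∧ t (τ + 2 * Real.pi) = t τ + j 0 * L :=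
    fun τ => by rw [← hconst τ]; exact ⟨hj1 τ, hj2 τ⟩
  -- Without a shift the lift descends to the circle, which then factors through the contractible
  -- strip.
  have hn : j 0 ≠ 0 := by
    intro h0
    rw [h0] at hper
    simp only [Int.cast_zero, zero_mul, add_zero] at hper
    have hq := Circle.isCoveringMap_exp.isQuotientMap Circle.exp_surjective
    have hfac : ∀ {f : ℝ → ℝ}, Function.Periodic f (2 * Real.pi) →
        Function.FactorsThrough f Circle.exp := fun hf a b hab => by
      obtain ⟨m, rfl⟩ := Circle.exp_eq_exp.1 hab
      exact hf.add_int_mul b m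
    let S := hq.lift ⟨s, hs⟩ (hfac fun τ => (hper τ).1)
    let T := hq.lift ⟨t, ht⟩ (hfac fun τ => (hper τ).2)
    have hS : ∀ τ, S (Circle.exp τ) = s τ := fun τ =>
      DFunLike.congr_fun (hq.lift_comp ⟨s, hs⟩ (hfac fun τ => (hper τ).1)) τ
    have hT : ∀ τ, T (Circle.exp τ) = t τ := fun τ =>
      DFunLike.congr_fun (hq.lift_comp ⟨t, ht⟩ (hfac fun τ => (hper τ).2)) τ
    refine hc (nullhomotopic_of_lift h hθ c S.continuous T.continuous (fun u => ?_) fun u => ?_)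
    · obtain ⟨τ, rfl⟩ := Circle.exp_surjective u
      rw [hS, hT]
      exact hst τ
    · obtain ⟨τ, rfl⟩ := Circle.exp_surjective u
      rw [hS, hT]
      exact hcst τ
  have hsurj : ∀ u, ∃ τ, (c u).1 = (γ (s τ), γ (t τ)) := fun u => by
    obtain ⟨τ, rfl⟩ := Circle.exp_surjective u
    exact ⟨τ, hcst τ⟩
  rcases lt_or_gt_of_ne hn with hn | hn
  · refine ⟨fun τ => s (-τ), fun τ => t (-τ), -j 0, by omega, by fun_prop, by fun_prop,
      fun τ => hst _, fun τ => ?_, fun τ => ⟨_, hcst _⟩, fun u => ?_⟩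
    · have e : -τ = -(τ + 2 * Real.pi) + 2 * Real.pi := by ring
      have := hper (-(τ + 2 * Real.pi))
      rw [← e] at this
      push_cast
      constructor <;> linarith [this.1, this.2]
    · obtain ⟨τ, hτ⟩ := hsurj u
      exact ⟨-τ, by simpa only [neg_neg] using hτ⟩
  · exact ⟨s, t, j 0, hn, hs, ht, hst, hper, fun τ => ⟨_, hcst τ⟩, hsurj⟩

/-- The billiard map is onto on the lift of an invariant circle. -/
theorem image_billiard_liftedSet (h : IsClosedConvexCurve γ L) (hθ : IsTangentAngle γ L θ)
    {c : C(Circle, phaseSpace γ)} (hc : IsInvariantCircle γ c) :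
    billiard γ θ '' liftedSet γ θ (range fun u => (c u).1) =
      liftedSet γ θ (range fun u => (c u).1) := by
  choose v hv using hc.invariant
  have key : ∀ {x y : ℝ}, (x, y) ∈ strip θ → ∀ u, (c u).1 = (γ x, γ y) →
      (c (v u)).1 = (γ (billiard γ θ (x, y)).1, γ (billiard γ θ (x, y)).2) := by
    intro x y hp u hu
    have := hv u
    rw [hu] at this
    exact eq_of_billiardStep h hθ hp (c (v u)).2 this
  -- The circle is embedded in the phase space, so continuity of `v` can be tested after applying
  -- `c` and lifting to the line.
  have hvc : Continuous v := by
    have hemb := (c.continuous.isClosedEmbedding hc.injective).isEmbedding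
    rw [hemb.continuous_iff, Topology.IsEmbedding.subtypeVal.continuous_iff]
    have hq := Circle.isCoveringMap_exp.isQuotientMap Circle.exp_surjective
    rw [hq.continuous_iff]
    obtain ⟨s, t, hs, ht, hst, hcst⟩ := exists_lift h hθ c
    have e : (Subtype.val ∘ (c ∘ v)) ∘ Circle.exp = fun τ =>
        (γ (billiard γ θ (s τ, t τ)).1, γ (billiard γ θ (s τ, t τ)).2) :=
      funext fun τ => key (hst τ) _ (hcst τ)
    rw [e]
    have hb : Continuous fun τ => billiard γ θ (s τ, t τ) :=
      (continuousOn_billiard h hθ).comp_continuous (by fun_prop) hst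
    exact (h.continuous.comp (continuous_fst.comp hb)).prodMk
      (h.continuous.comp (continuous_snd.comp hb))
  have hvinj : Function.Injective v := by
    intro a b hab
    obtain ⟨s, t, hs, ht, hst, hcst⟩ := exists_lift h hθ c
    obtain ⟨τ, rfl⟩ := Circle.exp_surjective a
    obtain ⟨σ, rfl⟩ := Circle.exp_surjective b
    have k1 := key (hst τ) _ (hcst τ)
    have k2 := key (hst σ) _ (hcst σ)
    rw [hab, k2] at k1
    obtain ⟨j, hj1, hj2⟩ := eq_add_int_of_proj_eq h hθ (billiard_mem h hθ (hst σ))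
      (billiard_mem h hθ (hst τ)) (congrArg Prod.fst k1).symm (congrArg Prod.snd k1).symm
    have h1 : billiard γ θ (s τ, t τ) = billiard γ θ (s σ + j * L, t σ + j * L) := by
      rw [billiard_add_int h hθ (hst σ)]
      exact Prod.ext hj1 hj2
    have h2 := injOn_billiard h hθ (hst τ) ((hθ.add_int_mem j).2 (hst σ)) h1
    apply hc.injective
    apply Subtype.ext
    obtain ⟨h3, h4⟩ := Prod.mk.inj h2
    rw [hcst, hcst, h3, h4, h.periodic.add_int_mul, h.periodic.add_int_mul]
  -- Invariance only gives a map of the circle into itself; being continuous and injective, it is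
  -- onto.
  have hvs := surjective_of_injective_circle hvc hvinj
  ext ⟨y, z⟩
  constructor
  · rintro ⟨⟨x, y'⟩, ⟨hp, u, hu⟩, he⟩
    rw [← he]
    exact ⟨billiard_mem h hθ hp, v u, key hp u hu⟩
  · rintro ⟨hp, w, hw⟩
    obtain ⟨u, rfl⟩ := hvs w
    obtain ⟨s, t, hs, ht, hst, hcst⟩ := exists_lift h hθ c
    obtain ⟨τ, rfl⟩ := Circle.exp_surjective u
    have k := key (hst τ) _ (hcst τ)
    simp only at hw
    rw [hw] at k
    obtain ⟨j, hj1, hj2⟩ := eq_add_int_of_proj_eq h hθ (billiard_mem h hθ (hst τ)) hp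
      (congrArg Prod.fst k) (congrArg Prod.snd k)
    refine ⟨(s τ + j * L, t τ + j * L), ⟨(hθ.add_int_mem j).2 (hst τ), Circle.exp τ, ?_⟩, ?_⟩
    · simp only [hcst, h.periodic.add_int_mul]
    · rw [billiard_add_int h hθ (hst τ)]
      exact (Prod.ext hj1 hj2).symm

end IsTangentAngle

/-! ### The full lift of an invariant circle. -/

/-- The properties of the full lift `C` of an invariant circle to the strip. -/
structure IsLiftedCircle (γ : ℝ → Plane) (L : ℝ) (θ : ℝ → ℝ) (C : Set (ℝ × ℝ)) : Prop where
  isClosed : IsClosed C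
  subset : C ⊆ strip θ
  add_int_mem : ∀ s t (j : ℤ), (s + j * L, t + j * L) ∈ C ↔ (s, t) ∈ C
  image : billiard γ θ '' C = C
  exists_path : ∀ r ∈ C, ∃ ρ : ℝ → ℝ × ℝ, Continuous ρ ∧ (∀ τ, ρ τ ∈ C) ∧ (∃ τ, ρ τ = r) ∧
    Tendsto (fun τ => (ρ τ).1) atBot atBot
  exists_right : ∀ s, ∃ t, (s, t) ∈ C
  exists_left : ∀ t, ∃ s, (s, t) ∈ C
  exists_gap : ∃ ε > 0, ∀ p ∈ C, ε ≤ θ p.2 - θ p.1 ∧ θ p.2 - θ p.1 ≤ Real.pi - ε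

/-- Subtracting the linear drift leaves a continuous periodic, hence bounded, function. -/
theorem tendsto_of_quasiperiodic {f : ℝ → ℝ} (hf : Continuous f) {P a : ℝ} (hP : 0 < P)
    (ha : 0 < a) (h : ∀ τ, f (τ + P) = f τ + a) :
    Tendsto f atBot atBot ∧ Tendsto f atTop atTop := by
  have hper : Function.Periodic (fun τ => f τ - a / P * τ) P := fun τ => by
    simp only [h]
    field_simp
    ring
  have hb := hper.isBounded_of_continuous hP.ne' (by fun_prop)
  obtain ⟨M, hM⟩ := hb.exists_norm_le
  have hM : ∀ τ, |f τ - a / P * τ| ≤ M := fun τ => hM _ ⟨τ, rfl⟩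
  have e : f = fun τ => a / P * τ + (f τ - a / P * τ) := by funext τ; ring
  have hpos : 0 < a / P := by positivity
  rw [e]
  constructor
  · exact tendsto_atBot_add_right_of_ge _ M (tendsto_id.const_mul_atBot hpos)
      fun τ => (abs_le.1 (hM τ)).2
  · exact tendsto_atTop_add_right_of_le _ (-M) (tendsto_id.const_mul_atTop hpos)
      fun τ => (abs_le.1 (hM τ)).1

theorem IsInvariantCircle.isLiftedCircle {γ : ℝ → Plane} {L : ℝ} {θ : ℝ → ℝ}
    (h : IsClosedConvexCurve γ L) (hθ : IsTangentAngle γ L θ) {c : C(Circle, phaseSpace γ)}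
    (hc : IsInvariantCircle γ c) :
    IsLiftedCircle γ L θ (liftedSet γ θ (range fun u => (c u).1)) := by
  have hL := h.period_pos
  obtain ⟨s, t, n, hn, hs, ht, hst, hper, hmem, hsurj⟩ :=
    hθ.exists_periodic_lift h c hc.essential
  have hnL : 0 < (n : ℝ) * L := mul_pos (by exact_mod_cast hn) hL
  have hpi : (0 : ℝ) < 2 * Real.pi := by have := Real.pi_pos; positivity
  have hts := tendsto_of_quasiperiodic hs hpi hnL fun τ => (hper τ).1
  have htt := tendsto_of_quasiperiodic ht hpi hnL fun τ => (hper τ).2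
  have hC : ∀ τ, (s τ, t τ) ∈ liftedSet γ θ (range fun u => (c u).1) := fun τ => ⟨hst τ, hmem τ⟩
  have hrep : ∀ r ∈ liftedSet γ θ (range fun u => (c u).1),
      ∃ τ, ∃ j : ℤ, r = (s τ + j * L, t τ + j * L) := by
    rintro ⟨x, y⟩ ⟨hp, u, hu⟩
    obtain ⟨τ, hτ⟩ := hsurj u
    have e : (γ x, γ y) = (γ (s τ), γ (t τ)) := hu.symm.trans hτ
    obtain ⟨j, rfl, rfl⟩ := hθ.eq_add_int_of_proj_eq h (hst τ) hp (congrArg Prod.fst e)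
      (congrArg Prod.snd e)
    exact ⟨τ, j, rfl⟩
  have hgap : ∃ ε > 0, ∀ p ∈ liftedSet γ θ (range fun u => (c u).1),
      ε ≤ θ p.2 - θ p.1 ∧ θ p.2 - θ p.1 ≤ Real.pi - ε := by
    set f : ℝ → ℝ := fun τ => θ (t τ) - θ (s τ) with hf
    have hfc : Continuous f := (hθ.continuous.comp ht).sub (hθ.continuous.comp hs)
    have hfp : Function.Periodic f (2 * Real.pi) := fun τ => by
      simp only [hf, (hper τ).1, (hper τ).2, hθ.add_int]; ring
    have hcomp := hfp.compact_of_continuous hpi.ne' hfc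
    obtain ⟨a, ha⟩ := hcomp.exists_isLeast (range_nonempty f)
    obtain ⟨b, hb⟩ := hcomp.exists_isGreatest (range_nonempty f)
    have ha0 : 0 < a := by
      obtain ⟨τ, rfl⟩ := ha.1
      exact (hst τ).1
    have hbpi : b < Real.pi := by
      obtain ⟨τ, rfl⟩ := hb.1
      exact (hst τ).2
    refine ⟨min a (Real.pi - b), lt_min ha0 (by linarith), fun p hp => ?_⟩
    obtain ⟨τ, j, rfl⟩ := hrep p hp
    simp only [hθ.add_int, add_sub_add_right_eq_sub]
    have h1 := ha.2 ⟨τ, rfl⟩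
    have h2 := hb.2 ⟨τ, rfl⟩
    have h3 := min_le_left a (Real.pi - b)
    have h4 := min_le_right a (Real.pi - b)
    constructor <;> simp only [hf] at h1 h2 <;> linarith
  refine ⟨?_, fun p hp => hp.1, fun x y j => ?_, hθ.image_billiard_liftedSet h hc, ?_, ?_, ?_, hgap⟩
  · obtain ⟨ε, hε, hg⟩ := hgap
    -- The strip is open, but the uniform gap replaces it by closed inequalities.
    have e : liftedSet γ θ (range fun u => (c u).1) =
        {p | ε ≤ θ p.2 - θ p.1} ∩ {p | θ p.2 - θ p.1 ≤ Real.pi - ε} ∩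
          (fun p : ℝ × ℝ => (γ p.1, γ p.2)) ⁻¹' range fun u => (c u).1 := by
      ext p
      constructor
      · exact fun hp => ⟨hg p hp, hp.2⟩
      · rintro ⟨⟨h1, h2⟩, h3⟩
        simp only [mem_ofPred_eq] at h1 h2
        exact ⟨⟨by linarith, by linarith⟩, h3⟩
    have hcont : Continuous fun p : ℝ × ℝ => θ p.2 - θ p.1 := by
      have := hθ.continuous
      fun_prop
    have hK : IsClosed (range fun u => (c u).1) :=
      (isCompact_range (by fun_prop : Continuous fun u => (c u).1)).isClosed
    rw [e]
    refine ((isClosed_le continuous_const hcont).inter (isClosed_le hcont continuous_const)).inter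
      (hK.preimage ?_)
    have := h.continuous
    fun_prop
  · simp only [liftedSet, mem_ofPred_eq, hθ.add_int_mem, h.periodic.add_int_mul]
  · intro r hr
    obtain ⟨τ, j, rfl⟩ := hrep r hr
    refine ⟨fun σ => (s σ + j * L, t σ + j * L), by fun_prop, fun σ => ⟨(hθ.add_int_mem j).2 (hst σ),
      ?_⟩, ⟨τ, rfl⟩, tendsto_atBot_add_const_right _ _ hts.1⟩
    simp only [h.periodic.add_int_mul]
    exact hmem σ
  · intro x
    obtain ⟨τ, rfl⟩ := hs.surjective hts.2 hts.1 x
    exact ⟨_, hC τ⟩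
  · intro x
    obtain ⟨τ, rfl⟩ := ht.surjective htt.2 htt.1 x
    exact ⟨_, hC τ⟩

/-! ### Regions below the lifted circle and the winding argument. -/

/-- The part of the strip below `C`, seen along vertical lines. -/
def vertRegion (θ : ℝ → ℝ) (C : Set (ℝ × ℝ)) : Set (ℝ × ℝ) :=
  {p | p ∈ strip θ ∧ ∀ t ≤ p.2, (p.1, t) ∉ C}

/-- The part of the strip below `C`, seen along horizontal lines. -/
def horRegion (θ : ℝ → ℝ) (C : Set (ℝ × ℝ)) : Set (ℝ × ℝ) :=
  {p | p ∈ strip θ ∧ ∀ s, p.1 ≤ s → (s, p.2) ∉ C}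

/-- `α` is a continuous argument of the nonvanishing complex function `w`. -/
structure IsArgument (w : ℝ → ℂ) (α : ℝ → ℝ) : Prop where
  continuous : Continuous α
  ne_zero : ∀ τ, w τ ≠ 0
  eq : ∀ τ, w τ = ‖w τ‖ * Complex.exp (α τ * Complex.I)

namespace IsArgument

variable {w : ℝ → ℂ} {α : ℝ → ℝ}

theorem re_eq (h : IsArgument w α) (τ : ℝ) : (w τ).re = ‖w τ‖ * Real.cos (α τ) := by
  have := congrArg Complex.re (h.eq τ)
  rwa [Complex.re_ofReal_mul, Complex.exp_ofReal_mul_I_re] at this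

theorem im_eq (h : IsArgument w α) (τ : ℝ) : (w τ).im = ‖w τ‖ * Real.sin (α τ) := by
  have := congrArg Complex.im (h.eq τ)
  rwa [Complex.im_ofReal_mul, Complex.exp_ofReal_mul_I_im] at this

theorem norm_pos (h : IsArgument w α) (τ : ℝ) : 0 < ‖w τ‖ := norm_pos_iff.2 (h.ne_zero τ)

/-- Multiplying by a function with values in the slit plane. -/
theorem mul_slit (h : IsArgument w α) {v : ℝ → ℂ} (hv : Continuous v)
    (hs : ∀ τ, v τ ∈ Complex.slitPlane) :
    IsArgument (fun τ => w τ * v τ) fun τ => α τ + (v τ).arg := by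
  refine ⟨h.continuous.add ?_, fun τ => mul_ne_zero (h.ne_zero τ)
    (Complex.slitPlane_ne_zero (hs τ)), fun τ => ?_⟩
  · exact continuous_iff_continuousAt.2 fun τ => (Complex.continuousAt_arg (hs τ)).comp
      hv.continuousAt
  · conv_lhs => rw [h.eq τ, ← Complex.norm_mul_exp_arg_mul_I (v τ)]
    rw [norm_mul, Complex.ofReal_mul, Complex.ofReal_add, add_mul, Complex.exp_add]
    ring

theorem mul_const (h : IsArgument w α) (a : ℝ) :
    IsArgument (fun τ => w τ * Complex.exp (a * Complex.I)) fun τ => α τ + a := by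
  refine ⟨h.continuous.add continuous_const, fun τ => mul_ne_zero (h.ne_zero τ)
    (Complex.exp_ne_zero _), fun τ => ?_⟩
  rw [norm_mul, Complex.norm_exp_ofReal_mul_I, mul_one, Complex.ofReal_add, add_mul,
    Complex.exp_add, ← mul_assoc, ← h.eq τ]

end IsArgument

/-- The vector from `r` to `q` as a complex number. -/
def offset (q r : ℝ × ℝ) : ℂ := ⟨q.1 - r.1, q.2 - r.2⟩

theorem continuous_offset (q : ℝ × ℝ) : Continuous (offset q) := by
  have e : offset q = fun r => ((q.1 - r.1 : ℝ) : ℂ) + ((q.2 - r.2 : ℝ) : ℂ) * Complex.I := by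
    funext r
    apply Complex.ext <;> simp [offset]
  rw [e]
  fun_prop

/-- The points of the strip around which `C`, coming from `-∞`, never turns so far that it passes
under them. -/
def lowRegion (θ : ℝ → ℝ) (C : Set (ℝ × ℝ)) : Set (ℝ × ℝ) :=
  {q | q ∈ strip θ ∧ ∀ r ∈ C, ∃ ρ : ℝ → ℝ × ℝ, Continuous ρ ∧ (∀ τ, ρ τ ∈ C) ∧ (∃ τ, ρ τ = r) ∧
    Tendsto (fun τ => (ρ τ).1) atBot atBot ∧ ∃ α : ℝ → ℝ,
      IsArgument (fun τ => offset q (ρ τ)) α ∧ (∀ᶠ τ in atBot, 0 < α τ) ∧ ∀ τ, α τ < Real.pi / 2}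

namespace IsLiftedCircle

variable {γ : ℝ → Plane} {L : ℝ} {θ : ℝ → ℝ} {C : Set (ℝ × ℝ)}

/-- This normalises the argument near `-∞`: there `C` lies below and to the left of `q`, as its
second coordinate exceeds the first by less than `L`. -/
theorem eventually_quadrant (hθ : IsTangentAngle γ L θ) (hC : IsLiftedCircle γ L θ C)
    (q : ℝ × ℝ) {ρ : ℝ → ℝ × ℝ} (hρ : ∀ τ, ρ τ ∈ C)
    (hbot : Tendsto (fun τ => (ρ τ).1) atBot atBot) :
    ∀ᶠ τ in atBot, 0 < (offset q (ρ τ)).re ∧ 0 < (offset q (ρ τ)).im := by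
  filter_upwards [hbot.eventually_lt_atBot (min q.1 (q.2 - L))] with τ h
  have h1 := lt_of_lt_of_le h (min_le_left _ _)
  have h2 := lt_of_lt_of_le h (min_le_right _ _)
  have h3 := hθ.lt_add_of_mem (hC.subset (hρ τ))
  constructor <;> simp only [offset] <;> linarith

/-- The billiard takes the part of a horizontal line to the right of `p` to the part of a vertical
line below the image, and preserves `C`. -/
theorem mem_horRegion_iff (h : IsClosedConvexCurve γ L) (hθ : IsTangentAngle γ L θ)
    (hC : IsLiftedCircle γ L θ C) {p : ℝ × ℝ} (hp : p ∈ strip θ) :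
    p ∈ horRegion θ C ↔ billiard γ θ p ∈ vertRegion θ C := by
  have hn := hθ.isNext_billiard h hp
  constructor
  · rintro ⟨-, hfree⟩
    refine ⟨hθ.billiard_mem h hp, fun t ht hmem => ?_⟩
    rw [← hC.image] at hmem
    obtain ⟨⟨x', y'⟩, hx', he⟩ := hmem
    obtain rfl : y' = p.2 := congrArg Prod.fst he
    have hn' := (hθ.isNext_iff h).2 ⟨hC.subset hx', he⟩
    exact hfree x' ((hθ.le_iff_of_isNext h hn hn').2 ht) hx'
  · rintro ⟨-, hfree⟩
    refine ⟨hp, fun s hs hmem => ?_⟩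
    have hn' := hθ.isNext_billiard h (hC.subset hmem)
    refine hfree _ ((hθ.le_iff_of_isNext h hn hn').1 hs) ?_
    have : billiard γ θ (s, p.2) ∈ C := by
      rw [← hC.image]; exact mem_image_of_mem _ hmem
    exact this

theorem vertRegion_subset_lowRegion (hθ : IsTangentAngle γ L θ) (hC : IsLiftedCircle γ L θ C) :
    vertRegion θ C ⊆ lowRegion θ C := by
  rintro q ⟨hq, hfree⟩
  refine ⟨hq, fun r hr => ?_⟩
  obtain ⟨ρ, hρ, hρC, hr, hbot⟩ := hC.exists_path r hr
  -- A point of `C` below `q` makes the offset a positive multiple of `I`, so multiplication by `I`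
  -- puts it on the cut of the principal argument.
  set v : ℝ → ℂ := fun τ => Complex.I * offset q (ρ τ) with hv
  have hvc : Continuous v := continuous_const.mul ((continuous_offset q).comp hρ)
  have hvs : ∀ τ, v τ ∈ Complex.slitPlane := fun τ => by
    rw [Complex.mem_slitPlane_iff]
    by_contra hcon
    push Not at hcon
    obtain ⟨h1, h2⟩ := hcon
    simp [hv, offset] at h1 h2
    refine hfree (ρ τ).2 h1 ?_
    rw [show q.1 = (ρ τ).1 by linarith]
    exact hρC τ
  have h1 : IsArgument (fun _ => (1 : ℂ)) fun _ => 0 :=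
    ⟨continuous_const, fun _ => one_ne_zero, fun _ => by simp⟩
  have h2 := (h1.mul_slit hvc hvs).mul_const (-(Real.pi / 2))
  have e : (fun τ => 1 * v τ * Complex.exp ((-(Real.pi / 2) : ℝ) * Complex.I)) =
      fun τ => offset q (ρ τ) := by
    funext τ
    have : Complex.exp ((-(Real.pi / 2) : ℝ) * Complex.I) = -Complex.I := by
      rw [Complex.exp_mul_I, ← Complex.ofReal_cos, ← Complex.ofReal_sin]
      simp
    rw [this, hv]
    linear_combination (-offset q (ρ τ)) * Complex.I_mul_I
  rw [e] at h2
  refine ⟨ρ, hρ, hρC, hr, hbot, _, h2, ?_, fun τ => ?_⟩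
  · filter_upwards [eventually_quadrant hθ hC q hρC hbot] with τ hτ
    have : Real.pi / 2 < (v τ).arg := by
      by_contra hle
      rw [not_lt, Complex.arg_le_pi_div_two_iff] at hle
      simp [hv] at hle
      rcases hle with hle | hle <;> linarith
    linarith
  · have := Complex.arg_lt_pi_iff.2 (Complex.mem_slitPlane_iff.1 (hvs τ) |>.imp le_of_lt id)
    linarith

/-- A point of `C` below `q` has argument `π/2` modulo `2π`, and being less than `π/2` it is below
`-π`. The argument starts positive, so it passes `-π`, where `C` lies to the right of `q`. -/
theorem lowRegion_inter_horRegion_subset :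
    lowRegion θ C ∩ horRegion θ C ⊆ vertRegion θ C := by
  rintro q ⟨⟨hq, hlow⟩, -, hfree⟩
  refine ⟨hq, fun t ht hmem => ?_⟩
  obtain ⟨ρ, hρ, hρC, ⟨τ₁, hτ₁⟩, hbot, α, hα, hev, hlt⟩ := hlow _ hmem
  have hpi := Real.pi_pos
  have h1 : (offset q (ρ τ₁)).re = 0 := by simp [offset, hτ₁]
  have h2 : 0 < (offset q (ρ τ₁)).im := by
    have h3 : 0 ≤ (offset q (ρ τ₁)).im := by simp [offset, hτ₁, ht]
    refine lt_of_le_of_ne h3 fun h0 => hα.ne_zero τ₁ (Complex.ext h1 h0.symm)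
  have hneg : α τ₁ < -Real.pi := by
    by_contra hle
    push Not at hle
    have hp := hα.norm_pos τ₁
    have hc : Real.cos (α τ₁) = 0 := by
      rw [hα.re_eq] at h1
      exact (mul_eq_zero.1 h1).resolve_left hp.ne'
    have hs : 0 < Real.sin (α τ₁) := by
      rw [hα.im_eq] at h2
      exact pos_of_mul_pos_right h2 hp.le
    have h0 : 0 < α τ₁ := by
      by_contra hle'
      have := Real.sin_nonpos_of_nonpos_of_neg_pi_le (not_lt.1 hle') hle
      linarith
    exact absurd hc (Real.cos_pos_of_mem_Ioo ⟨by linarith, hlt τ₁⟩).ne'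
  obtain ⟨τ₀, hτ₀⟩ := hev.exists
  obtain ⟨τ, hτ⟩ := mem_range_of_exists_le_of_exists_ge hα.continuous
    ⟨τ₁, hneg.le⟩ ⟨τ₀, (by linarith : -Real.pi ≤ α τ₀)⟩
  have h5 := hα.re_eq τ
  have h6 := hα.im_eq τ
  have hp := hα.norm_pos τ
  rw [hτ, Real.cos_neg, Real.cos_pi] at h5
  rw [hτ, Real.sin_neg, Real.sin_pi] at h6
  simp only [offset] at h5 h6
  refine hfree (ρ τ).1 ?_ ?_
  · simp only [offset] at hp
    linarith
  · have : q.2 = (ρ τ).2 := by linarith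
    rw [this]
    exact hρC τ

/-- The billiard acts on offsets like a quarter turn up to an error of less than a half turn, so a
continuous argument can be transported along the path and its bound recovered. -/
theorem billiard_mem_lowRegion (h : IsClosedConvexCurve γ L) (hθ : IsTangentAngle γ L θ)
    (hC : IsLiftedCircle γ L θ C) {q : ℝ × ℝ} (hq : q ∈ lowRegion θ C) :
    billiard γ θ q ∈ lowRegion θ C := by
  obtain ⟨hqs, hlow⟩ := hq
  refine ⟨hθ.billiard_mem h hqs, fun r' hr' => ?_⟩
  rw [← hC.image] at hr'
  obtain ⟨r, hr, rfl⟩ := hr'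
  obtain ⟨ρ, hρ, hρC, ⟨τ₁, hτ₁⟩, hbot, α, hα, hev, hlt⟩ := hlow r hr
  have hpi := Real.pi_pos
  set σ : ℝ → ℝ × ℝ := fun τ => billiard γ θ (ρ τ) with hσ
  have hσc : Continuous σ :=
    (hθ.continuousOn_billiard h).comp_continuous hρ fun τ => hC.subset (hρC τ)
  have hσC : ∀ τ, σ τ ∈ C := fun τ => by
    rw [← hC.image]; exact mem_image_of_mem _ (hρC τ)
  have hσbot : Tendsto (fun τ => (σ τ).1) atBot atBot := by
    refine tendsto_atBot_mono (fun τ => ?_) (tendsto_atBot_add_const_right _ L hbot)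
    exact (hθ.lt_add_of_mem (hC.subset (hρC τ))).le
  set w : ℝ → ℂ := fun τ => offset q (ρ τ) with hw
  -- The factor `I` undoes the quarter turn: `u` and `w` have equal imaginary parts, and the twist
  -- makes their real parts agree in sign when these vanish. Hence they are never opposite, which is
  -- `hslit`.
  set u : ℝ → ℂ := fun τ => Complex.I * offset (billiard γ θ q) (σ τ) with hu
  have hure : ∀ τ, (u τ).re = -((billiard γ θ q).2 - (σ τ).2) := fun τ => by
    simp [hu, offset]
  have huim : ∀ τ, (u τ).im = (w τ).im := fun τ => by
    simp [hu, hw, offset, hσ, billiard]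
  have hsign : ∀ τ, (w τ).im = 0 → 0 < (w τ).re * (u τ).re := fun τ h0 => by
    have hre : (w τ).re ≠ 0 := fun h1 => hα.ne_zero τ (Complex.ext h1 h0)
    have e : (ρ τ).2 = q.2 := by simp [hw, offset] at h0; linarith
    have n1 := hθ.isNext_billiard h hqs
    have n2 := hθ.isNext_billiard h (hC.subset (hρC τ))
    rw [e] at n2
    rw [hure]
    have hre' : (w τ).re = q.1 - (ρ τ).1 := rfl
    rw [hre'] at hre ⊢
    rcases lt_or_gt_of_ne hre with hlt | hgt
    · have := (hθ.lt_iff_of_isNext h n1 n2).1 (by linarith)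
      exact mul_pos_of_neg_of_neg hlt (by simp only [hσ]; linarith)
    · have := (hθ.lt_iff_of_isNext h n2 n1).1 (by linarith)
      exact mul_pos hgt (by simp only [hσ]; linarith)
  have hwc : Continuous w := (continuous_offset q).comp hρ
  have huc : Continuous u := continuous_const.mul ((continuous_offset _).comp hσc)
  have hslit : ∀ τ, u τ / w τ ∈ Complex.slitPlane := fun τ => by
    have hN := Complex.normSq_pos.2 (hα.ne_zero τ)
    have hwN : (w τ).re * (w τ).re + (w τ).im * (w τ).im = Complex.normSq (w τ) := rfl
    rw [Complex.mem_slitPlane_iff, Complex.div_re, Complex.div_im, ← add_div, ← sub_div]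
    by_contra hcon
    push Not at hcon
    obtain ⟨h1, h2⟩ := hcon
    have h1' : (u τ).re * (w τ).re + (u τ).im * (w τ).im ≤ 0 := by
      by_contra hpos
      exact absurd h1 (not_le.2 (div_pos (not_le.1 hpos) hN))
    have h2' : (u τ).im * (w τ).re - (u τ).re * (w τ).im = 0 :=
      (div_eq_zero_iff.1 h2).resolve_right hN.ne'
    rw [huim] at h1' h2'
    by_cases h0 : (w τ).im = 0
    · have := hsign τ h0
      rw [h0] at h1'
      nlinarith
    · have h3 : (u τ).re = (w τ).re := by
        have : (w τ).im * ((w τ).re - (u τ).re) = 0 := by linarith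
        linarith [(mul_eq_zero.1 this).resolve_left h0]
      rw [h3] at h1'
      have h4 : 0 < (w τ).im * (w τ).im := mul_self_pos.2 h0
      nlinarith [mul_self_nonneg (w τ).re]
  have hquot : Continuous fun τ => u τ / w τ := huc.div hwc hα.ne_zero
  have hβ := hα.mul_slit hquot hslit
  have e : (fun τ => w τ * (u τ / w τ)) = u := funext fun τ => mul_div_cancel₀ _ (hα.ne_zero τ)
  rw [e] at hβ
  set β : ℝ → ℝ := fun τ => α τ + (u τ / w τ).arg with hβdef
  have hquadσ := eventually_quadrant hθ hC (billiard γ θ q) hσC hσbot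
  -- If `u` is negative real, so is `w`, and the correction `arg (u / w)` vanishes. Then `α τ = π`,
  -- contrary to `α < π/2`.
  have hβpi : ∀ τ, β τ ≠ Real.pi := by
    intro τ hτ
    have h5 := hβ.re_eq τ
    have h6 := hβ.im_eq τ
    have hp := hβ.norm_pos τ
    rw [hτ, Real.cos_pi] at h5
    rw [hτ, Real.sin_pi, mul_zero] at h6
    have h7 : (w τ).im = 0 := by rw [← huim]; exact h6
    have h8 := hsign τ h7
    have h9 : (u τ).re < 0 := by rw [h5]; linarith
    have h10 : (w τ).re < 0 := by
      by_contra hge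
      nlinarith
    have h11 : (u τ / w τ).arg = 0 := by
      have e1 : u τ = ((u τ).re : ℂ) := Complex.ext rfl (by simp [h6])
      have e2 : w τ = ((w τ).re : ℂ) := Complex.ext rfl (by simp [h7])
      rw [e1, e2, ← Complex.ofReal_div]
      exact Complex.arg_ofReal_of_nonneg (div_nonneg_of_nonpos h9.le h10.le)
    have h12 := hlt τ
    simp only [hβdef, h11, add_zero] at hτ
    linarith
  -- The quadrants determine the new argument up to `2π`, and the bounds on `α` and the correction
  -- leave one branch.
  have hβlow : ∀ᶠ τ in atBot, Real.pi / 2 < β τ ∧ β τ < Real.pi := by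
    filter_upwards [hev, hquadσ, eventually_quadrant hθ hC q hρC hbot] with τ h0 hq1 hq2
    have hp := hβ.norm_pos τ
    have hs : 0 < Real.sin (β τ) := by
      have h6 := hβ.im_eq τ
      rw [huim] at h6
      have : 0 < (w τ).im := hq2.2
      rw [h6] at this
      exact pos_of_mul_pos_right this hp.le
    have hc : Real.cos (β τ) < 0 := by
      have h5 := hβ.re_eq τ
      have h6 : (u τ).re < 0 := by rw [hure]; exact neg_neg_iff_pos.2 hq1.2
      rw [h5] at h6
      by_contra hge
      exact absurd h6 (not_lt.2 (mul_nonneg hp.le (not_lt.1 hge)))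
    have ha1 := Complex.neg_pi_lt_arg (u τ / w τ)
    have ha2 := Complex.arg_le_pi (u τ / w τ)
    have hb1 : -Real.pi < β τ := by simp only [hβdef]; linarith
    have hb2 : β τ < 3 * Real.pi / 2 := by simp only [hβdef]; linarith [hlt τ]
    have hb3 : 0 < β τ := by
      by_contra hle
      have := Real.sin_nonpos_of_nonpos_of_neg_pi_le (not_lt.1 hle) hb1.le
      linarith
    refine ⟨?_, ?_⟩
    · by_contra hle
      have := Real.cos_nonneg_of_mem_Icc ⟨by linarith, not_lt.1 hle⟩
      linarith
    · by_contra hge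
      have := Real.sin_nonneg_of_nonneg_of_le_pi (show 0 ≤ β τ - Real.pi by linarith)
        (by linarith)
      rw [Real.sin_sub_pi] at this
      linarith
  have hβlt : ∀ τ, β τ < Real.pi := by
    intro τ
    by_contra hge
    obtain ⟨τ₀, hτ₀⟩ := hβlow.exists
    obtain ⟨τ', hτ'⟩ := mem_range_of_exists_le_of_exists_ge hβ.continuous
      ⟨τ₀, hτ₀.2.le⟩ ⟨τ, not_lt.1 hge⟩
    exact hβpi τ' hτ'
  have hfin := hβ.mul_const (-(Real.pi / 2))
  have e2 : (fun τ => u τ * Complex.exp ((-(Real.pi / 2) : ℝ) * Complex.I)) =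
      fun τ => offset (billiard γ θ q) (σ τ) := by
    funext τ
    have : Complex.exp ((-(Real.pi / 2) : ℝ) * Complex.I) = -Complex.I := by
      rw [Complex.exp_mul_I, ← Complex.ofReal_cos, ← Complex.ofReal_sin]
      simp
    rw [this, hu]
    linear_combination (-offset (billiard γ θ q) (σ τ)) * Complex.I_mul_I
  rw [e2] at hfin
  refine ⟨σ, hσc, hσC, ⟨τ₁, by simp only [hσ, hτ₁]⟩, hσbot, _, hfin, ?_, fun τ => ?_⟩
  · filter_upwards [hβlow] with τ hτ
    linarith [hτ.1]
  · linarith [hβlt τ]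

end IsLiftedCircle

/-! ### The invariant area. -/

/-- Invariance of a set under the diagonal translations by multiples of `L`. -/
def IsShiftInvariant (L : ℝ) (S : Set (ℝ × ℝ)) : Prop :=
  ∀ s t (j : ℤ), (s + j * L, t + j * L) ∈ S ↔ (s, t) ∈ S

theorem isAddFundamentalDomain_of_coord {L : ℝ} (hL : 0 < L) {f : ℝ × ℝ → ℝ}
    (hf : Continuous f) (hadd : ∀ (j : ℤ) p, f (j • (L, L) + p) = f p + j • L) :
    IsAddFundamentalDomain (AddSubgroup.zmultiples ((L, L) : ℝ × ℝ)) (f ⁻¹' Ico 0 L) volume := by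
  refine IsAddFundamentalDomain.mk' (hf.measurable measurableSet_Ico).nullMeasurableSet fun p => ?_
  obtain ⟨j, hj, huniq⟩ := existsUnique_add_zsmul_mem_Ico hL (f p) 0
  rw [zero_add] at hj
  refine ⟨⟨j • (L, L), j, rfl⟩, ?_, ?_⟩
  · change f (j • (L, L) + p) ∈ Ico 0 L
    rw [hadd]
    exact hj
  · rintro ⟨_, i, rfl⟩ hi
    change f (i • (L, L) + p) ∈ Ico 0 L at hi
    rw [hadd] at hi
    have := huniq i (by simpa using hi)
    subst this
    rfl

theorem isAddFundamentalDomain_fst {L : ℝ} (hL : 0 < L) :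
    IsAddFundamentalDomain (AddSubgroup.zmultiples ((L, L) : ℝ × ℝ)) (Ico 0 L ×ˢ (univ : Set ℝ))
      volume := by
  have := isAddFundamentalDomain_of_coord hL continuous_fst fun j p => by simp; ring
  rwa [← Set.prod_univ] at this

theorem isAddFundamentalDomain_snd {L : ℝ} (hL : 0 < L) :
    IsAddFundamentalDomain (AddSubgroup.zmultiples ((L, L) : ℝ × ℝ)) ((univ : Set ℝ) ×ˢ Ico 0 L)
      volume := by
  have := isAddFundamentalDomain_of_coord hL continuous_snd fun j p => by simp; ring
  rwa [← Set.univ_prod] at this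

/-- The density of the invariant area form of the billiard. -/
noncomputable def density (γ : ℝ → Plane) (p : ℝ × ℝ) : ENNReal :=
  ENNReal.ofReal (area (deriv γ p.1) (deriv γ p.2))

/-- The invariant area of the phase annulus, on a fundamental domain of the strip. -/
noncomputable def annulusMeasure (γ : ℝ → Plane) (L : ℝ) : Measure (ℝ × ℝ) :=
  (volume.restrict (Ico 0 L ×ˢ univ)).withDensity (density γ)

namespace IsTangentAngle

variable {γ : ℝ → Plane} {L : ℝ} {θ : ℝ → ℝ}

theorem _root_.SymplecticBilliard.IsClosedConvexCurve.continuous_area_deriv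
    (h : IsClosedConvexCurve γ L) :
    Continuous fun p : ℝ × ℝ => area (deriv γ p.1) (deriv γ p.2) :=
  continuous_area.comp ((h.continuous_deriv.comp continuous_fst).prodMk
    (h.continuous_deriv.comp continuous_snd))

theorem _root_.SymplecticBilliard.IsClosedConvexCurve.measurable_density
    (h : IsClosedConvexCurve γ L) : Measurable (density γ) :=
  h.continuous_area_deriv.measurable.ennreal_ofReal

theorem annulusMeasure_eq (h : IsClosedConvexCurve γ L) {S : Set (ℝ × ℝ)} (hS : MeasurableSet S) :
    annulusMeasure γ L S = ∫⁻ s in Ico 0 L, ∫⁻ t, S.indicator (density γ) (s, t) := by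
  rw [annulusMeasure, withDensity_apply _ hS, ← lintegral_indicator hS, Measure.volume_eq_prod,
    setLIntegral_prod _ (h.measurable_density.indicator hS).aemeasurable]
  simp

/-- Restricting the first or the second coordinate to one period gives two fundamental domains of
the same translations, with equal integrals of an invariant function. -/
theorem annulusMeasure_eq_symm (h : IsClosedConvexCurve γ L) {S : Set (ℝ × ℝ)}
    (hS : MeasurableSet S) (hper : IsShiftInvariant L S) :
    annulusMeasure γ L S = ∫⁻ t in Ico 0 L, ∫⁻ s, S.indicator (density γ) (s, t) := by
  have hL := h.period_pos
  rw [annulusMeasure, withDensity_apply _ hS, ← lintegral_indicator hS,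
    (isAddFundamentalDomain_fst hL).setLIntegral_eq (isAddFundamentalDomain_snd hL),
    Measure.volume_eq_prod,
    setLIntegral_prod_symm _ (h.measurable_density.indicator hS).aemeasurable]
  · simp
  · rintro ⟨_, j, rfl⟩ ⟨s, t⟩
    have e : (⟨j • (L, L), j, rfl⟩ : AddSubgroup.zmultiples ((L, L) : ℝ × ℝ)) +ᵥ (s, t) =
        (s + j * L, t + j * L) := by
      change (j • (L, L) + (s, t) : ℝ × ℝ) = _
      ext <;> simp <;> ring
    change S.indicator (density γ) ((⟨j • (L, L), j, rfl⟩ :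
      AddSubgroup.zmultiples ((L, L) : ℝ × ℝ)) +ᵥ (s, t)) = _
    rw [e]
    have hd : density γ (s + j * L, t + j * L) = density γ (s, t) := by
      simp only [density, h.periodic_deriv.add_int_mul]
    by_cases hm : (s, t) ∈ S
    · rw [indicator_of_mem hm, indicator_of_mem ((hper s t j).2 hm), hd]
    · rw [indicator_of_notMem hm, indicator_of_notMem (fun h' => hm ((hper s t j).1 h'))]

theorem isShiftInvariant_image (h : IsClosedConvexCurve γ L) (hθ : IsTangentAngle γ L θ)
    {S : Set (ℝ × ℝ)} (hS : S ⊆ strip θ) (hper : IsShiftInvariant L S) :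
    IsShiftInvariant L (billiard γ θ '' S) := by
  have key : ∀ s t (j : ℤ), (s, t) ∈ billiard γ θ '' S →
      (s + j * L, t + j * L) ∈ billiard γ θ '' S := by
    rintro s t j ⟨⟨x, y⟩, hx, he⟩
    refine ⟨(x + j * L, y + j * L), (hper x y j).2 hx, ?_⟩
    rw [billiard_add_int h hθ (hS hx), he]
  refine fun s t j => ⟨fun hm => ?_, key s t j⟩
  have := key _ _ (-j) hm
  push_cast at this
  simpa using this

theorem measurableSet_image (h : IsClosedConvexCurve γ L) (hθ : IsTangentAngle γ L θ)
    {S : Set (ℝ × ℝ)} (hm : MeasurableSet S) (hS : S ⊆ strip θ) :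
    MeasurableSet (billiard γ θ '' S) :=
  hm.image_of_continuousOn_injOn ((continuousOn_billiard h hθ).mono hS)
    ((injOn_billiard h hθ).mono hS)

/-- The billiard map preserves the area. -/
theorem annulusMeasure_image (h : IsClosedConvexCurve γ L) (hθ : IsTangentAngle γ L θ)
    {S : Set (ℝ × ℝ)} (hm : MeasurableSet S) (hS : S ⊆ strip θ) (hper : IsShiftInvariant L S) :
    annulusMeasure γ L (billiard γ θ '' S) = annulusMeasure γ L S := by
  have him := measurableSet_image h hθ hm hS
  rw [annulusMeasure_eq h him, annulusMeasure_eq_symm h hm hper]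
  -- The comparison is made for each fixed middle point `y`. The density is the absolute derivative
  -- of `height γ y` on both sides, so each slice integral is the length of a set of heights.
  refine lintegral_congr fun y => ?_
  have m1 : MeasurableSet {z | (y, z) ∈ billiard γ θ '' S} := measurable_prodMk_left him
  have m2 : MeasurableSet {x | (x, y) ∈ S} := measurable_prodMk_right hm
  have hsub : billiard γ θ '' S ⊆ strip θ := by
    rintro _ ⟨p, hp, rfl⟩
    exact billiard_mem h hθ (hS hp)
  have e1 : ∫⁻ z, (billiard γ θ '' S).indicator (density γ) (y, z) =
      ∫⁻ z in {z | (y, z) ∈ billiard γ θ '' S},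
        ENNReal.ofReal |area (deriv γ y) (deriv γ z)| * 1 := by
    rw [← lintegral_indicator m1]
    refine lintegral_congr fun z => ?_
    by_cases hz : (y, z) ∈ billiard γ θ '' S
    · rw [indicator_of_mem hz, indicator_of_mem (show z ∈ {z | (y, z) ∈ billiard γ θ '' S} from hz),
        abs_of_pos (area_deriv_pos h hθ (hsub hz)), mul_one, density]
    · rw [indicator_of_notMem hz,
        indicator_of_notMem (show z ∉ {z | (y, z) ∈ billiard γ θ '' S} from hz)]
  have e2 : ∫⁻ x, S.indicator (density γ) (x, y) =
      ∫⁻ x in {x | (x, y) ∈ S}, ENNReal.ofReal |area (deriv γ y) (deriv γ x)| * 1 := by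
    rw [← lintegral_indicator m2]
    refine lintegral_congr fun x => ?_
    by_cases hx : (x, y) ∈ S
    · rw [indicator_of_mem hx, indicator_of_mem (show x ∈ {x | (x, y) ∈ S} from hx),
        area_swap, abs_neg, abs_of_pos (area_deriv_pos h hθ (hS hx)), mul_one, density]
    · rw [indicator_of_notMem hx, indicator_of_notMem (show x ∉ {x | (x, y) ∈ S} from hx)]
  rw [e1, e2, ← lintegral_image_eq_lintegral_abs_deriv_mul m1
      (fun z _ => (h.hasDerivAt_height y z).hasDerivWithinAt)
      ((strictMonoOn_height h hθ y).injOn.mono fun z hz => hsub hz) (fun _ => 1),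
    ← lintegral_image_eq_lintegral_abs_deriv_mul m2
      (fun z _ => (h.hasDerivAt_height y z).hasDerivWithinAt)
      ((strictAntiOn_height h hθ y).injOn.mono fun z hz => hS hz) (fun _ => 1)]
  -- The incoming and outgoing points over `y` have the same heights, so the two image sets
  -- coincide.
  congr 2
  ext v
  constructor
  · rintro ⟨z, ⟨⟨x, y'⟩, hx, he⟩, rfl⟩
    obtain rfl : y' = y := congrArg Prod.fst he
    have hn := (isNext_iff h hθ).2 ⟨hS hx, he⟩
    exact ⟨x, hx, hn.2.2.symm⟩
  · rintro ⟨x, hx, rfl⟩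
    have hn := isNext_billiard h hθ (hS hx)
    exact ⟨_, mem_image_of_mem (billiard γ θ) hx, hn.2.2⟩

theorem annulusMeasure_strip_lt_top (h : IsClosedConvexCurve γ L) (hθ : IsTangentAngle γ L θ) :
    annulusMeasure γ L (strip θ) < ⊤ := by
  have hm := hθ.isOpen_strip.measurableSet
  have hK : IsCompact (Icc 0 L ×ˢ Icc 0 (2 * L)) := isCompact_Icc.prod isCompact_Icc
  obtain ⟨M, hM⟩ := hK.exists_bound_of_continuousOn h.continuous_area_deriv.continuousOn
  rw [annulusMeasure, withDensity_apply _ hm, Measure.restrict_restrict hm]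
  have hsub : strip θ ∩ Ico 0 L ×ˢ univ ⊆ Icc 0 L ×ˢ Icc 0 (2 * L) := by
    rintro ⟨s, t⟩ ⟨hp, hs, -⟩
    have h1 := hθ.lt_of_mem hp
    have h2 := hθ.lt_add_of_mem hp
    have h3 : 0 ≤ s := hs.1
    have h4 : s < L := hs.2
    exact ⟨⟨h3, h4.le⟩, ⟨by simp only; linarith, by simp only; linarith⟩⟩
  calc ∫⁻ p in strip θ ∩ Ico 0 L ×ˢ univ, density γ p
      ≤ ∫⁻ p in Icc 0 L ×ˢ Icc 0 (2 * L), density γ p := lintegral_mono_set hsub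
    _ ≤ ∫⁻ _ in Icc 0 L ×ˢ Icc 0 (2 * L), ENNReal.ofReal M :=
        setLIntegral_mono measurable_const fun p hp =>
          ENNReal.ofReal_le_ofReal ((le_abs_self _).trans (hM p hp))
    _ < ⊤ := by
        rw [setLIntegral_const]
        exact ENNReal.mul_lt_top ENNReal.ofReal_lt_top hK.measure_lt_top

end IsTangentAngle

/-! ### The two regions agree almost everywhere. -/

namespace IsLiftedCircle

variable {γ : ℝ → Plane} {L : ℝ} {θ : ℝ → ℝ} {C : Set (ℝ × ℝ)}

/-- The points having `C` at or below them form a closed set: the witnesses `t` lie between the two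
coordinates, so a subsequence converges. -/
theorem isOpen_vertRegion (hθ : IsTangentAngle γ L θ) (hC : IsLiftedCircle γ L θ C) :
    IsOpen (vertRegion θ C) := by
  have hcl : IsClosed {p : ℝ × ℝ | ∃ t ≤ p.2, (p.1, t) ∈ C} := by
    apply IsSeqClosed.isClosed
    intro p q hp hpq
    choose t ht htC using hp
    have h1 : Tendsto (fun n => (p n).1) atTop (𝓝 q.1) := (continuous_fst.tendsto q).comp hpq
    have h2 : Tendsto (fun n => (p n).2) atTop (𝓝 q.2) := (continuous_snd.tendsto q).comp hpq
    obtain ⟨a, ha⟩ := (Metric.isBounded_range_of_tendsto _ h1).bddBelow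
    obtain ⟨b, hb⟩ := (Metric.isBounded_range_of_tendsto _ h2).bddAbove
    have hmem : ∀ n, t n ∈ Icc a b := fun n =>
      ⟨(ha ⟨n, rfl⟩).trans (hθ.lt_of_mem (hC.subset (htC n))).le, (ht n).trans (hb ⟨n, rfl⟩)⟩
    obtain ⟨c, -, φ, hφ, hc⟩ := isCompact_Icc.tendsto_subseq hmem
    have h1' := h1.comp hφ.tendsto_atTop
    have h2' := h2.comp hφ.tendsto_atTop
    exact ⟨c, le_of_tendsto_of_tendsto' hc h2' fun n => ht _,
      hC.isClosed.mem_of_tendsto (h1'.prodMk_nhds hc) (Eventually.of_forall fun n => htC _)⟩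
  have e : vertRegion θ C = strip θ ∩ {p : ℝ × ℝ | ∃ t ≤ p.2, (p.1, t) ∈ C}ᶜ := by
    ext p
    simp [vertRegion]
  rw [e]
  exact hθ.isOpen_strip.inter hcl.isOpen_compl

theorem isOpen_horRegion (h : IsClosedConvexCurve γ L) (hθ : IsTangentAngle γ L θ)
    (hC : IsLiftedCircle γ L θ C) : IsOpen (horRegion θ C) := by
  have e : horRegion θ C = strip θ ∩ billiard γ θ ⁻¹' vertRegion θ C := by
    ext p
    constructor
    · exact fun hp => ⟨hp.1, (hC.mem_horRegion_iff h hθ hp.1).1 hp⟩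
    · exact fun hp => (hC.mem_horRegion_iff h hθ hp.1).2 hp.2
  rw [e]
  exact (hθ.continuousOn_billiard h).isOpen_inter_preimage hθ.isOpen_strip
    (hC.isOpen_vertRegion hθ)

theorem image_horRegion (h : IsClosedConvexCurve γ L) (hθ : IsTangentAngle γ L θ)
    (hC : IsLiftedCircle γ L θ C) : billiard γ θ '' horRegion θ C = vertRegion θ C := by
  ext q
  constructor
  · rintro ⟨p, hp, rfl⟩
    exact (hC.mem_horRegion_iff h hθ hp.1).1 hp
  · intro hq
    obtain ⟨p, hp, rfl⟩ := hθ.surjOn_billiard h hq.1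
    exact ⟨p, (hC.mem_horRegion_iff h hθ hp).2 hq, rfl⟩

theorem isShiftInvariant_vertRegion (hθ : IsTangentAngle γ L θ) (hC : IsLiftedCircle γ L θ C) :
    IsShiftInvariant L (vertRegion θ C) := by
  intro s t j
  simp only [vertRegion, mem_ofPred_eq, hθ.add_int_mem]
  refine and_congr_right fun _ => ⟨fun hf r hr hm => ?_, fun hf r hr hm => ?_⟩
  · exact hf (r + j * L) (by linarith) ((hC.add_int_mem s r j).2 hm)
  · refine hf (r - j * L) (by linarith) ((hC.add_int_mem s _ j).1 ?_)
    rwa [sub_add_cancel]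

theorem isShiftInvariant_horRegion (hθ : IsTangentAngle γ L θ) (hC : IsLiftedCircle γ L θ C) :
    IsShiftInvariant L (horRegion θ C) := by
  intro s t j
  simp only [horRegion, mem_ofPred_eq, hθ.add_int_mem]
  refine and_congr_right fun _ => ⟨fun hf r hr hm => ?_, fun hf r hr hm => ?_⟩
  · exact hf (r + j * L) (by linarith) ((hC.add_int_mem r t j).2 hm)
  · refine hf (r - j * L) (by linarith) ((hC.add_int_mem _ t j).1 ?_)
    rwa [sub_add_cancel]

theorem _root_.SymplecticBilliard.IsShiftInvariant.diff {S T : Set (ℝ × ℝ)}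
    (hS : IsShiftInvariant L S) (hT : IsShiftInvariant L T) : IsShiftInvariant L (S \ T) :=
  fun s t j => and_congr (hS s t j) (not_congr (hT s t j))

/-- Vertically seen and horizontally seen points below `C` agree up to a null set. -/
theorem annulusMeasure_horRegion_diff (h : IsClosedConvexCurve γ L) (hθ : IsTangentAngle γ L θ)
    (hC : IsLiftedCircle γ L θ C) :
    annulusMeasure γ L (horRegion θ C \ vertRegion θ C) = 0 := by
  set V := vertRegion θ C with hV
  set S : ℕ → Set (ℝ × ℝ) := fun n => Nat.iterate (billiard γ θ '' ·) n V with hSdef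
  have hS0 : S 0 = V := rfl
  have hSs : ∀ n, S (n + 1) = billiard γ θ '' S n := fun n =>
    Function.iterate_succ_apply' (billiard γ θ '' ·) n V
  have hgood : ∀ n, MeasurableSet (S n) ∧ S n ⊆ lowRegion θ C ∧ IsShiftInvariant L (S n) := by
    intro n
    induction n with
    | zero =>
      exact ⟨(hC.isOpen_vertRegion hθ).measurableSet, hC.vertRegion_subset_lowRegion hθ,
        hC.isShiftInvariant_vertRegion hθ⟩
    | succ n ih =>
      rw [hSs]
      refine ⟨hθ.measurableSet_image h ih.1 fun p hp => (ih.2.1 hp).1, ?_,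
        hθ.isShiftInvariant_image h (fun p hp => (ih.2.1 hp).1) ih.2.2⟩
      rintro _ ⟨p, hp, rfl⟩
      exact hC.billiard_mem_lowRegion h hθ (ih.2.1 hp)
  -- The forward orbit of `V` stays in `lowRegion` and is mapped into itself; as its area is finite
  -- and preserved, `E` minus its image is null.
  set E : Set (ℝ × ℝ) := ⋃ n, S n with hE
  have hEm : MeasurableSet E := MeasurableSet.iUnion fun n => (hgood n).1
  have hElow : E ⊆ lowRegion θ C := iUnion_subset fun n => (hgood n).2.1
  have hEstrip : E ⊆ strip θ := fun p hp => (hElow hp).1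
  have hEshift : IsShiftInvariant L E := fun s t j => by
    simp only [hE, mem_iUnion]
    exact exists_congr fun n => (hgood n).2.2 s t j
  have hEE : billiard γ θ '' E ⊆ E := by
    rw [hE, image_iUnion]
    exact iUnion_subset fun n => by rw [← hSs]; exact subset_iUnion S (n + 1)
  have hfin : annulusMeasure γ L E ≠ ⊤ :=
    ((measure_mono hEstrip).trans_lt (hθ.annulusMeasure_strip_lt_top h)).ne
  have hnull : annulusMeasure γ L (E \ billiard γ θ '' E) = 0 := by
    have := ae_eq_of_subset_of_measure_ge hEE (hθ.annulusMeasure_image h hEm hEstrip hEshift).ge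
      (hθ.measurableSet_image h hEm hEstrip).nullMeasurableSet hfin
    exact ae_le_set.1 this.symm.le
  have hZm : MeasurableSet (horRegion θ C \ V) :=
    (hC.isOpen_horRegion h hθ).measurableSet.diff (hC.isOpen_vertRegion hθ).measurableSet
  rw [← hθ.annulusMeasure_image h hZm (fun p hp => hp.1.1)
    ((hC.isShiftInvariant_horRegion hθ).diff (hC.isShiftInvariant_vertRegion hθ))]
  -- The image of `horRegion θ C \ V` lies in `V` but misses the image of `E`: by injectivity a
  -- preimage in `E` would be in `lowRegion` and `horRegion`, hence in `V`.
  refine measure_mono_null ?_ hnull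
  rintro _ ⟨p, hp, rfl⟩
  refine ⟨mem_iUnion.2 ⟨0, (hC.mem_horRegion_iff h hθ hp.1.1).1 hp.1⟩, ?_⟩
  rintro ⟨q, hq, he⟩
  obtain rfl := hθ.injOn_billiard h (hEstrip hq) hp.1.1 he
  exact hp.2 (lowRegion_inter_horRegion_subset ⟨hElow hq, hp.1⟩)

/-- The regions have equal finite area, as one is the image of the other, so the one-sided null
difference is two-sided. The positive density on the strip and shift invariance turn this into a
Lebesgue statement. -/
theorem ae_mem_vertRegion_iff (h : IsClosedConvexCurve γ L) (hθ : IsTangentAngle γ L θ)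
    (hC : IsLiftedCircle γ L θ C) :
    ∀ᵐ p : ℝ × ℝ, p ∈ vertRegion θ C ↔ p ∈ horRegion θ C := by
  have hL := h.period_pos
  have hVm := (hC.isOpen_vertRegion hθ).measurableSet
  have hHm := (hC.isOpen_horRegion h hθ).measurableSet
  have h1 := hC.annulusMeasure_horRegion_diff h hθ
  have heq : annulusMeasure γ L (horRegion θ C) = annulusMeasure γ L (vertRegion θ C) := by
    rw [← hC.image_horRegion h hθ, hθ.annulusMeasure_image h hHm (fun p hp => hp.1)
      (hC.isShiftInvariant_horRegion hθ)]
  have hfin : annulusMeasure γ L (vertRegion θ C) ≠ ⊤ :=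
    ((measure_mono fun p hp => hp.1).trans_lt (hθ.annulusMeasure_strip_lt_top h)).ne
  have hae : horRegion θ C ≤ᵐ[annulusMeasure γ L] vertRegion θ C := ae_le_set.2 h1
  have h2 : annulusMeasure γ L (vertRegion θ C \ horRegion θ C) = 0 :=
    ae_le_set.1 (ae_eq_of_ae_subset_of_measure_ge hae heq.ge hHm.nullMeasurableSet hfin).symm.le
  have key : ∀ {S T : Set (ℝ × ℝ)}, S ⊆ strip θ → IsShiftInvariant L (S \ T) →
      annulusMeasure γ L (S \ T) = 0 → volume (S \ T) = 0 := by
    intro S T hS hinv h0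
    refine (isAddFundamentalDomain_fst hL).measure_zero_of_invariant _ ?_ ?_
    · rintro ⟨_, j, rfl⟩
      ext ⟨s, t⟩
      rw [mem_vadd_set_iff_neg_vadd_mem]
      have e : -(⟨j • (L, L), j, rfl⟩ : AddSubgroup.zmultiples ((L, L) : ℝ × ℝ)) +ᵥ (s, t) =
          (s + (-j : ℤ) * L, t + (-j : ℤ) * L) := by
        change (-(j • (L, L)) + (s, t) : ℝ × ℝ) = _
        ext <;> simp <;> ring
      refine Iff.trans (iff_of_eq (congrArg (· ∈ S \ T) e)) (hinv s t (-j))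
    · rw [annulusMeasure, withDensity_apply_eq_zero h.measurable_density,
        Measure.restrict_apply₀' (measurableSet_Ico.prod MeasurableSet.univ).nullMeasurableSet] at h0
      refine measure_mono_null ?_ h0
      rintro p ⟨hp, hF⟩
      exact ⟨⟨(ENNReal.ofReal_pos.2 (hθ.area_deriv_pos h (hS hp.1))).ne', hp⟩, hF⟩
  have hv := hC.isShiftInvariant_vertRegion hθ
  have hh := hC.isShiftInvariant_horRegion hθ
  have k1 := key (fun p hp => hp.1) (hh.diff hv) h1
  have k2 := key (fun p hp => hp.1) (hv.diff hh) h2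
  filter_upwards [measure_eq_zero_iff_ae_notMem.1 k1, measure_eq_zero_iff_ae_notMem.1 k2]
    with p p1 p2
  constructor
  · exact fun hp => by_contra fun hn => p2 ⟨hp, hn⟩
  · exact fun hp => by_contra fun hn => p1 ⟨hp, hn⟩

end IsLiftedCircle

/-! ### The twist estimate. -/

theorem abs_area_le (u v : Plane) : |area u v| ≤ ‖u‖ * ‖v‖ := by
  rw [area_eq_im, ← norm_toComplex u, ← norm_toComplex v]
  refine (Complex.abs_im_le_norm _).trans ?_
  rw [norm_mul, RCLike.norm_conj]

theorem sin_ge_of_mem_Icc {e x : ℝ} (he : 0 < e) (hx : x ∈ Icc e (Real.pi - e)) :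
    Real.sin e ≤ Real.sin x := by
  have := hx.1
  have := hx.2
  rcases le_total x (Real.pi / 2) with h | h
  · exact Real.sin_le_sin_of_le_of_le_pi_div_two (by linarith) h hx.1
  · rw [← Real.sin_pi_sub x]
    exact Real.sin_le_sin_of_le_of_le_pi_div_two (by linarith) (by linarith) (by linarith)

namespace IsTangentAngle

variable {γ : ℝ → Plane} {L : ℝ} {θ : ℝ → ℝ}

/-- A common shift by periods brings nearby arguments into a fixed compact interval. -/
theorem uniformContinuous (h : IsClosedConvexCurve γ L) (hθ : IsTangentAngle γ L θ) {ε : ℝ}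
    (hε : 0 < ε) : ∃ δ > 0, ∀ a b, |a - b| < δ → |θ a - θ b| < ε := by
  have hL := h.period_pos
  have hu := isCompact_Icc.uniformContinuousOn_of_continuous
    (hθ.continuous.continuousOn (s := Icc (-L) (2 * L)))
  obtain ⟨δ, hδ, hd⟩ := Metric.uniformContinuousOn_iff.1 hu ε hε
  refine ⟨min δ L, lt_min hδ hL, fun a b hab => ?_⟩
  obtain ⟨j, hj, -⟩ := existsUnique_add_zsmul_mem_Ico hL a 0
  rw [zsmul_eq_mul, zero_add] at hj
  have h1 := hab.trans_le (min_le_left _ _)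
  have h2 := abs_lt.1 (hab.trans_le (min_le_right _ _))
  have h3 := hj.1
  have h4 := hj.2
  have := hd (a + j * L) ⟨by linarith, by linarith⟩ (b + j * L) ⟨by linarith, by linarith⟩
    (by rw [Real.dist_eq, add_sub_add_right_eq_sub]; exact h1)
  rwa [Real.dist_eq, hθ.add_int, hθ.add_int, add_sub_add_right_eq_sub] at this

theorem area_deriv_ge (hθ : IsTangentAngle γ L θ) {m e : ℝ} (hm : 0 ≤ m)
    (hγ : ∀ t, m ≤ ‖deriv γ t‖) (he : 0 < e) {s t : ℝ}
    (hst : θ t - θ s ∈ Icc e (Real.pi - e)) :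
    m * m * Real.sin e ≤ area (deriv γ s) (deriv γ t) := by
  have h1 := hst.1
  have h2 := hst.2
  rw [hθ.area_deriv]
  exact mul_le_mul (mul_le_mul (hγ s) (hγ t) hm (norm_nonneg _)) (sin_ge_of_mem_Icc he hst)
    (Real.sin_nonneg_of_nonneg_of_le_pi he.le (by linarith)) (by positivity)

/-- The twist estimate for two ordered orbit segments. -/
theorem twist_estimate (h : IsClosedConvexCurve γ L) (hθ : IsTangentAngle γ L θ) {m e : ℝ}
    (hm : 0 ≤ m) (hγ : ∀ t, m ≤ ‖deriv γ t‖) (he : 0 < e) {x₁ y₁ z₁ x₂ y₂ z₂ : ℝ}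
    (h₁ : height γ y₁ z₁ = height γ y₁ x₁) (h₂ : height γ y₂ z₂ = height γ y₂ x₂)
    (hx : x₁ ≤ x₂) (hz : z₁ ≤ z₂)
    (hy : |θ y₂ - θ y₁| < e) (a₁ : θ y₁ - θ x₁ ≤ Real.pi - 2 * e) (b₁ : 2 * e ≤ θ z₁ - θ y₁)
    (a₂ : 2 * e ≤ θ y₂ - θ x₂) (b₂ : θ z₂ - θ y₂ ≤ Real.pi - 2 * e) :
    m * m * Real.sin e * (z₂ - z₁) + m * m * Real.sin e * (x₂ - x₁) ≤
      area (deriv γ y₂ - deriv γ y₁) (γ x₂ - γ z₂) := by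
  have hy := abs_lt.1 hy
  -- Both increments use the height over `y₁`; the margin `e` absorbs the change of angle from `y₁`
  -- to `y₂`, so the derivative bound holds on the whole interval.
  have k1 : m * m * Real.sin e * (z₂ - z₁) ≤ height γ y₁ z₂ - height γ y₁ z₁ := by
    refine (convex_Icc z₁ z₂).mul_sub_le_image_sub_of_le_deriv
      (h.continuous_height_right y₁).continuousOn
      (fun r _ => (h.hasDerivAt_height y₁ r).differentiableAt.differentiableWithinAt)
      (fun r hr => ?_) z₁ (left_mem_Icc.2 hz) z₂ (right_mem_Icc.2 hz) hz
    have hr := interior_subset hr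
    rw [(h.hasDerivAt_height y₁ r).deriv]
    have := hθ.monotone hr.1
    have := hθ.monotone hr.2
    exact hθ.area_deriv_ge hm hγ he ⟨by linarith, by linarith⟩
  have k2 : m * m * Real.sin e * (x₂ - x₁) ≤ -height γ y₁ x₂ - -height γ y₁ x₁ := by
    refine (convex_Icc x₁ x₂).mul_sub_le_image_sub_of_le_deriv (f := fun r => -height γ y₁ r)
      (h.continuous_height_right y₁).neg.continuousOn
      (fun r _ => (h.hasDerivAt_height y₁ r).neg.differentiableAt.differentiableWithinAt)
      (fun r hr => ?_) x₁ (left_mem_Icc.2 hx) x₂ (right_mem_Icc.2 hx) hx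
    have hr := interior_subset hr
    rw [show deriv (fun r => -height γ y₁ r) r = _ from (h.hasDerivAt_height y₁ r).neg.deriv,
      ← area_swap]
    have := hθ.monotone hr.1
    have := hθ.monotone hr.2
    exact hθ.area_deriv_ge hm hγ he ⟨by linarith, by linarith⟩
  -- In the sum, the first orbit relation cancels the values at `x₁` and `z₁`. The second makes the
  -- `γ' y₂` term zero, leaving only the change of the velocity.
  rw [area_sub_left, area_sub_right, area_sub_right]
  simp only [height] at *
  linarith

end IsTangentAngle

/-! ### Monotone Lipschitz envelopes and the invariant graph. -/

namespace IsLiftedCircle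

variable {γ : ℝ → Plane} {L : ℝ} {θ : ℝ → ℝ} {C : Set (ℝ × ℝ)}

/-- The lowest point of `C` over `s`. -/
noncomputable def lower (C : Set (ℝ × ℝ)) (s : ℝ) : ℝ := sInf {t | (s, t) ∈ C}

/-- The rightmost point of `C` at the height `t`. -/
noncomputable def rightmost (C : Set (ℝ × ℝ)) (t : ℝ) : ℝ := sSup {s | (s, t) ∈ C}

theorem isLeast_lower (hθ : IsTangentAngle γ L θ) (hC : IsLiftedCircle γ L θ C) (s : ℝ) :
    IsLeast {t | (s, t) ∈ C} (lower C s) :=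
  (hC.isClosed.preimage (by fun_prop : Continuous fun t : ℝ => (s, t))).isLeast_csInf
    (hC.exists_right s) ⟨s, fun _ ht => (hθ.lt_of_mem (hC.subset ht)).le⟩

theorem isGreatest_rightmost (hθ : IsTangentAngle γ L θ) (hC : IsLiftedCircle γ L θ C) (t : ℝ) :
    IsGreatest {s | (s, t) ∈ C} (rightmost C t) :=
  (hC.isClosed.preimage (by fun_prop : Continuous fun s : ℝ => (s, t))).isGreatest_csSup
    (hC.exists_left t) ⟨t, fun _ ht => (hθ.lt_of_mem (hC.subset ht)).le⟩

theorem mem_vertRegion_iff (hθ : IsTangentAngle γ L θ) (hC : IsLiftedCircle γ L θ C) {s t : ℝ}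
    (hp : (s, t) ∈ strip θ) : (s, t) ∈ vertRegion θ C ↔ t < lower C s := by
  have hl := hC.isLeast_lower hθ s
  constructor
  · exact fun hv => not_le.1 fun hle => hv.2 _ hle hl.1
  · exact fun hlt => ⟨hp, fun r hr hm => absurd (hl.2 hm) (not_le.2 (lt_of_le_of_lt hr hlt))⟩

theorem mem_horRegion_iff_rightmost (hθ : IsTangentAngle γ L θ) (hC : IsLiftedCircle γ L θ C)
    {s t : ℝ} (hp : (s, t) ∈ strip θ) : (s, t) ∈ horRegion θ C ↔ rightmost C t < s := by
  have hl := hC.isGreatest_rightmost hθ t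
  constructor
  · exact fun hv => not_le.1 fun hle => hv.2 _ hle hl.1
  · exact fun hlt => ⟨hp, fun r hr hm => absurd (hl.2 hm) (not_le.2 (lt_of_lt_of_le hlt hr))⟩

/-- Order reversal and the invariance of `C` exchange the rightmost point at height `y` with the
lowest point over `y`. -/
theorem isNext_rightmost_lower (h : IsClosedConvexCurve γ L) (hθ : IsTangentAngle γ L θ)
    (hC : IsLiftedCircle γ L θ C) (y : ℝ) : IsNext γ θ (rightmost C y) y (lower C y) := by
  have hk := hC.isGreatest_rightmost hθ y
  have hg := hC.isLeast_lower hθ y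
  have n1 := hθ.isNext_billiard h (hC.subset hk.1)
  have m1 : billiard γ θ (rightmost C y, y) ∈ C := hC.image.le (mem_image_of_mem _ hk.1)
  obtain ⟨⟨x, y'⟩, hx, he⟩ := hC.image.ge hg.1
  obtain rfl : y' = y := congrArg Prod.fst he
  have n2 := (hθ.isNext_iff h).2 ⟨hC.subset hx, he⟩
  have h1 := (hθ.le_iff_of_isNext h n2 n1).1 (hk.2 hx)
  have h2 : lower C y' ≤ (billiard γ θ (rightmost C y', y')).2 := hg.2 m1
  rw [le_antisymm h2 h1]
  exact n1

/-- A set of full measure on which both envelopes are monotone. -/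
theorem exists_monotoneOn (h : IsClosedConvexCurve γ L) (hθ : IsTangentAngle γ L θ)
    (hC : IsLiftedCircle γ L θ C) : ∃ D : Set ℝ, (∀ᵐ y, y ∈ D) ∧ MonotoneOn (lower C) D ∧
      MonotoneOn (rightmost C) D := by
  have hae := hC.ae_mem_vertRegion_iff h hθ
  rw [Measure.volume_eq_prod] at hae
  have h1 := Measure.ae_ae_of_ae_prod hae
  have h2 := Measure.ae_ae_of_ae_prod
    (Measure.measurePreserving_swap.quasiMeasurePreserving.ae hae)
  refine ⟨{y | (∀ᵐ t, ((y, t) ∈ vertRegion θ C ↔ (y, t) ∈ horRegion θ C)) ∧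
    ∀ᵐ s, ((s, y) ∈ vertRegion θ C ↔ (s, y) ∈ horRegion θ C)}, ?_, ?_, ?_⟩
  · filter_upwards [h1, h2] with y p1 p2
    exact ⟨p1, p2⟩
  · intro a ha b hb hab
    by_contra hlt
    -- For almost every `t`, being below `lower` and being to the right of `rightmost` are
    -- equivalent. A value `t` in a downward jump would be below `lower` at `a`, hence also at the
    -- larger `b`, a contradiction.
    obtain ⟨t, ⟨t1, t2⟩, ht⟩ := (Measure.dense_of_ae (ha.1.and hb.1)).exists_between (not_le.1 hlt)
    have sa := hC.subset (hC.isLeast_lower hθ a).1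
    have sb := hC.subset (hC.isLeast_lower hθ b).1
    have o1 := hθ.monotone ht.1.le
    have o2 := hθ.monotone ht.2.le
    have o3 := hθ.monotone hab
    have q1 := sa.1
    have q2 := sa.2
    have q3 := sb.1
    have q4 := sb.2
    simp only at q1 q2 q3 q4
    have pa : (a, t) ∈ strip θ := ⟨by simp only; linarith, by simp only; linarith⟩
    have pb : (b, t) ∈ strip θ := ⟨by simp only; linarith, by simp only; linarith⟩
    rw [hC.mem_vertRegion_iff hθ pa, hC.mem_horRegion_iff_rightmost hθ pa] at t1
    rw [hC.mem_vertRegion_iff hθ pb, hC.mem_horRegion_iff_rightmost hθ pb] at t2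
    exact absurd (t2.2 ((t1.1 ht.2).trans_le hab)) (not_lt.2 ht.1.le)
  · intro a ha b hb hab
    by_contra hlt
    obtain ⟨t, ⟨t1, t2⟩, ht⟩ := (Measure.dense_of_ae (ha.2.and hb.2)).exists_between (not_le.1 hlt)
    have sa := hC.subset (hC.isGreatest_rightmost hθ a).1
    have sb := hC.subset (hC.isGreatest_rightmost hθ b).1
    have o1 := hθ.monotone ht.1.le
    have o2 := hθ.monotone ht.2.le
    have o3 := hθ.monotone hab
    have q1 := sa.1
    have q2 := sa.2
    have q3 := sb.1
    have q4 := sb.2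
    simp only at q1 q2 q3 q4
    have pa : (t, a) ∈ strip θ := ⟨by simp only; linarith, by simp only; linarith⟩
    have pb : (t, b) ∈ strip θ := ⟨by simp only; linarith, by simp only; linarith⟩
    rw [hC.mem_vertRegion_iff hθ pa, hC.mem_horRegion_iff_rightmost hθ pa] at t1
    rw [hC.mem_vertRegion_iff hθ pb, hC.mem_horRegion_iff_rightmost hθ pb] at t2
    exact absurd (t1.1 (hab.trans_lt (t2.2 ht.1))) (not_lt.2 ht.2.le)

theorem exists_norm_deriv_ge (h : IsClosedConvexCurve γ L) :
    ∃ m > 0, ∀ t, m ≤ ‖deriv γ t‖ := by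
  have hp : Function.Periodic (fun t => ‖deriv γ t‖) L := fun t => by
    simp only [h.periodic_deriv t]
  obtain ⟨m, ⟨t, rfl⟩, hm⟩ := (hp.compact_of_continuous h.period_pos.ne'
    h.continuous_deriv.norm).exists_isLeast (range_nonempty _)
  exact ⟨_, norm_pos_iff.2 (h.regular t), fun s => hm ⟨s, rfl⟩⟩

/-- The velocity is Lipschitz, since `γ''` is bounded, and chords are bounded; with the twist
estimate this gives the local Lipschitz bound for the envelopes. -/
theorem exists_area_sub_le (h : IsClosedConvexCurve γ L) :
    ∃ B ≥ 0, ∀ y₁ y₂ x z, |area (deriv γ y₂ - deriv γ y₁) (γ x - γ z)| ≤ B * |y₂ - y₁| := by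
  obtain ⟨R, hR⟩ := (h.periodic.compact_of_continuous h.period_pos.ne'
    h.continuous).isBounded.exists_norm_le
  obtain ⟨K, hK⟩ := (h.periodic_deriv_deriv.compact_of_continuous h.period_pos.ne'
    h.continuous_deriv_deriv).isBounded.exists_norm_le
  have hR : ∀ t, ‖γ t‖ ≤ R := fun t => hR _ ⟨t, rfl⟩
  have hK : ∀ t, ‖deriv (deriv γ) t‖ ≤ K := fun t => hK _ ⟨t, rfl⟩
  have hR0 : 0 ≤ R := (norm_nonneg _).trans (hR 0)
  have hK0 : 0 ≤ K := (norm_nonneg _).trans (hK 0)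
  refine ⟨K * (2 * R), by positivity, fun y₁ y₂ x z => (abs_area_le _ _).trans ?_⟩
  have h1 : ‖deriv γ y₂ - deriv γ y₁‖ ≤ K * ‖y₂ - y₁‖ :=
    convex_univ.norm_image_sub_le_of_norm_deriv_le
      (fun t _ => (h.hasDerivAt_deriv t).differentiableAt) (fun t _ => hK t) (mem_univ _)
      (mem_univ _)
  have h2 : ‖γ x - γ z‖ ≤ 2 * R := (norm_sub_le _ _).trans (by linarith [hR x, hR z])
  calc _ ≤ (K * ‖y₂ - y₁‖) * (2 * R) := by gcongr
    _ = _ := by rw [Real.norm_eq_abs]; ring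

/-- A monotone function with bounded displacement which is Lipschitz at small scales is
Lipschitz. -/
theorem exists_lipschitz_extension {f : ℝ → ℝ} {D : Set ℝ} (hf : MonotoneOn f D) {M δ L : ℝ}
    (hM : 0 ≤ M) (hδ : 0 < δ) (hL : 0 ≤ L)
    (hloc : ∀ a ∈ D, ∀ b ∈ D, a ≤ b → b - a < δ → f b - f a ≤ M * (b - a))
    (hdisp : ∀ a b, f b - f a ≤ b - a + L) :
    ∃ K : NNReal, ∃ F : ℝ → ℝ, LipschitzWith K F ∧ EqOn f F D := by
  set K : ℝ := M + 1 + L / δ with hK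
  have hK0 : 0 ≤ K := by positivity
  have key : ∀ a ∈ D, ∀ b ∈ D, a ≤ b → f b - f a ≤ K * (b - a) := by
    intro a ha b hb hab
    have h0 : 0 ≤ b - a := sub_nonneg.2 hab
    have hLδ : 0 ≤ L / δ := by positivity
    by_cases hlt : b - a < δ
    · refine (hloc a ha b hb hab hlt).trans ?_
      gcongr
      linarith
    · refine (hdisp a b).trans ?_
      have h1 : L ≤ L / δ * (b - a) := by
        rw [div_mul_eq_mul_div, le_div_iff₀ hδ]
        exact mul_le_mul_of_nonneg_left (not_lt.1 hlt) hL
      have h2 : 0 ≤ M * (b - a) := by positivity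
      rw [hK]
      linarith
  have hlip : LipschitzOnWith K.toNNReal f D := by
    refine LipschitzOnWith.of_dist_le_mul fun a ha b hb => ?_
    rw [Real.coe_toNNReal _ hK0, Real.dist_eq, Real.dist_eq]
    rcases le_total a b with hab | hab
    · rw [abs_sub_comm, abs_sub_comm a, abs_of_nonneg (sub_nonneg.2 (hf ha hb hab)),
        abs_of_nonneg (sub_nonneg.2 hab)]
      exact key a ha b hb hab
    · rw [abs_of_nonneg (sub_nonneg.2 (hf hb ha hab)), abs_of_nonneg (sub_nonneg.2 hab)]
      exact key b hb a ha hab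
  obtain ⟨F, hF, he⟩ := hlip.extend_real
  exact ⟨_, F, hF, he⟩

theorem monotone_of_dense {f : ℝ → ℝ} (hf : Continuous f) {D : Set ℝ} (hD : Dense D)
    (hm : MonotoneOn f D) : Monotone f := by
  intro a b hab
  rcases hab.eq_or_lt with rfl | hab
  · exact le_rfl
  have hcl : IsClosed {p : ℝ × ℝ | f p.1 ≤ f p.2} := isClosed_le (by fun_prop) (by fun_prop)
  have hop : IsOpen {p : ℝ × ℝ | p.1 < p.2} := isOpen_lt continuous_fst continuous_snd
  have hsub : {p : ℝ × ℝ | p.1 < p.2} ∩ D ×ˢ D ⊆ {p : ℝ × ℝ | f p.1 ≤ f p.2} :=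
    fun p hp => hm hp.2.1 hp.2.2 (le_of_lt hp.1)
  exact closure_minimal hsub hcl
    ((hD.prod hD).open_subset_closure_inter hop (show (a, b) ∈ _ from hab))

/-- An invariant circle contains a Lipschitz graph of orbits: there are monotone Lipschitz functions `G` and `K`, with `G` inverse to `K`, such
that `K y, y, G y` is an orbit segment for every `y`. -/
theorem exists_graph (h : IsClosedConvexCurve γ L) (hθ : IsTangentAngle γ L θ)
    (hC : IsLiftedCircle γ L θ C) : ∃ G K : ℝ → ℝ, ∃ M : NNReal, LipschitzWith M G ∧
      Continuous K ∧ Monotone G ∧ Monotone K ∧ (∀ y, (K y, y) ∈ C) ∧ (∀ y, (y, G y) ∈ C) ∧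
      (∀ y, height γ y (G y) = height γ y (K y)) ∧ ∀ y, G (K y) = y := by
  have hL := h.period_pos
  obtain ⟨D, hD, hg, hk⟩ := hC.exists_monotoneOn h hθ
  have hDd : Dense D := Measure.dense_of_ae hD
  obtain ⟨ε, hε, hgap⟩ := hC.exists_gap
  obtain ⟨m, hm, hmγ⟩ := exists_norm_deriv_ge h
  obtain ⟨B, hB, hBle⟩ := exists_area_sub_le h
  obtain ⟨δ, hδ, hθδ⟩ := hθ.uniformContinuous h (half_pos hε)
  have hgl : ∀ y, (y, lower C y) ∈ C := fun y => (hC.isLeast_lower hθ y).1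
  have hkr : ∀ y, (rightmost C y, y) ∈ C := fun y => (hC.isGreatest_rightmost hθ y).1
  have hεpi : ε ≤ Real.pi - ε := (hgap _ (hgl 0)).1.trans (hgap _ (hgl 0)).2
  set c := m * m * Real.sin (ε / 2) with hc
  have hc0 : 0 < c := by
    have := Real.sin_pos_of_pos_of_lt_pi (half_pos hε) (by linarith)
    positivity
  -- Both terms on the left of the twist estimate are nonnegative by monotonicity on `D`, so each is
  -- bounded separately.
  have hloc : ∀ a ∈ D, ∀ b ∈ D, a ≤ b → b - a < δ →
      lower C b - lower C a ≤ B / c * (b - a) ∧ rightmost C b - rightmost C a ≤ B / c * (b - a) := by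
    intro a ha b hb hab hlt
    have h1 := hg ha hb hab
    have h2 := hk ha hb hab
    have key := hθ.twist_estimate h hm.le hmγ (half_pos hε)
      (hC.isNext_rightmost_lower h hθ a).2.2 (hC.isNext_rightmost_lower h hθ b).2.2 h2 h1
      (hθδ b a (by rwa [abs_of_nonneg (sub_nonneg.2 hab)]))
      (by have := (hgap _ (hkr a)).2; simp only at this; linarith)
      (by have := (hgap _ (hgl a)).1; simp only at this; linarith)
      (by have := (hgap _ (hkr b)).1; simp only at this; linarith)
      (by have := (hgap _ (hgl b)).2; simp only at this; linarith)
    have h3 := (le_abs_self _).trans (hBle a b (rightmost C b) (lower C b))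
    rw [abs_of_nonneg (sub_nonneg.2 hab)] at h3
    rw [← hc] at key
    have h4 : 0 ≤ c * (lower C b - lower C a) := mul_nonneg hc0.le (sub_nonneg.2 h1)
    have h5 : 0 ≤ c * (rightmost C b - rightmost C a) := mul_nonneg hc0.le (sub_nonneg.2 h2)
    rw [div_mul_eq_mul_div]
    constructor
    · rw [le_div_iff₀ hc0]; linarith
    · rw [le_div_iff₀ hc0]; linarith
  obtain ⟨M, G, hG, hGe⟩ := exists_lipschitz_extension hg (div_nonneg hB hc0.le) hδ hL.le
    (fun a ha b hb hab hlt => (hloc a ha b hb hab hlt).1) fun a b => by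
      have h1 := hθ.lt_of_mem (hC.subset (hgl a))
      have h2 := hθ.lt_add_of_mem (hC.subset (hgl b))
      linarith
  obtain ⟨M', K, hK, hKe⟩ := exists_lipschitz_extension hk (div_nonneg hB hc0.le) hδ hL.le
    (fun a ha b hb hab hlt => (hloc a ha b hb hab hlt).2) fun a b => by
      have h1 := hθ.lt_add_of_mem (hC.subset (hkr a))
      have h2 := hθ.lt_of_mem (hC.subset (hkr b))
      linarith
  have hGc := hG.continuous
  have hKc := hK.continuous
  have ext : ∀ {S : Set ℝ}, IsClosed S → D ⊆ S → ∀ y, y ∈ S := fun hS hDS y =>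
    closure_minimal hDS hS (hDd y)
  have hKC : ∀ y, (K y, y) ∈ C :=
    ext (hC.isClosed.preimage (by fun_prop : Continuous fun y => (K y, y))) fun y hy => by
      change (K y, y) ∈ C
      rw [← hKe hy]; exact hkr y
  have hGC : ∀ y, (y, G y) ∈ C :=
    ext (hC.isClosed.preimage (by fun_prop : Continuous fun y => (y, G y))) fun y hy => by
      change (y, G y) ∈ C
      rw [← hGe hy]; exact hgl y
  refine ⟨G, K, M, hG, hKc, ?_, ?_, hKC, hGC, ?_, ?_⟩
  · refine monotone_of_dense hGc hDd fun a ha b hb hab => ?_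
    rw [← hGe ha, ← hGe hb]; exact hg ha hb hab
  · refine monotone_of_dense hKc hDd fun a ha b hb hab => ?_
    rw [← hKe ha, ← hKe hb]; exact hk ha hb hab
  · refine ext (S := {y | height γ y (G y) = height γ y (K y)}) (isClosed_eq
      (h.continuous_height.comp (by fun_prop : Continuous fun y => (y, G y)))
      (h.continuous_height.comp (by fun_prop : Continuous fun y => (y, K y)))) fun y hy => ?_
    rw [mem_ofPred_eq, ← hGe hy, ← hKe hy]
    exact (hC.isNext_rightmost_lower h hθ y).2.2
  -- The almost everywhere agreement of the regions says, on a dense set, that being below the graph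
  -- of `G` is being to the right of the graph of `K`. If `G (K y) ≠ y`, a small open set near `(K
  -- y, y)` violates this.
  · have hdense : Dense {p : ℝ × ℝ | (p.1 ∈ D ∧ p.2 ∈ D) ∧
        (p ∈ vertRegion θ C ↔ p ∈ horRegion θ C)} := by
      refine Measure.dense_of_ae (μ := volume) ?_
      have h1 : ∀ᵐ p : ℝ × ℝ, p.1 ∈ D := Measure.quasiMeasurePreserving_fst.ae hD
      have h2 : ∀ᵐ p : ℝ × ℝ, p.2 ∈ D := Measure.quasiMeasurePreserving_snd.ae hD
      exact (h1.and h2).and (hC.ae_mem_vertRegion_iff h hθ)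
    have hiff : ∀ {U : Set (ℝ × ℝ)}, IsOpen U → U.Nonempty → U ⊆ strip θ →
        ∃ p ∈ U, p.2 < G p.1 ↔ K p.2 < p.1 := by
      intro U hU hne hsub
      obtain ⟨p, hp, ⟨h1, h2⟩, h3⟩ := hdense.inter_open_nonempty U hU hne
      refine ⟨p, hp, ?_⟩
      rw [← hGe h1, ← hKe h2]
      rwa [← hC.mem_vertRegion_iff hθ (hsub hp), ← hC.mem_horRegion_iff_rightmost hθ (hsub hp)]
    intro y
    have hmem := hC.subset (hKC y)
    have hstrip : ∀ᶠ s in 𝓝 (K y), (s, y) ∈ strip θ :=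
      (hθ.isOpen_strip.preimage (by fun_prop : Continuous fun s : ℝ => (s, y))).mem_nhds hmem
    rcases lt_trichotomy (G (K y)) y with hlt | heq | hgt
    · exfalso
      have hev : ∀ᶠ s in 𝓝 (K y), G s < y := hGc.continuousAt.eventually_lt_const hlt
      obtain ⟨s, ⟨s1, s2⟩, s3⟩ := ((hstrip.and hev).filter_mono nhdsWithin_le_nhds |>.and
        (self_mem_nhdsWithin : Ioi (K y) ∈ 𝓝[>] (K y))).exists
      obtain ⟨p, ⟨⟨p1, p2⟩, p3⟩, hp⟩ := hiff (U := strip θ ∩ {p | G p.1 < p.2} ∩ {p | K p.2 < p.1})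
        ((hθ.isOpen_strip.inter (isOpen_lt (by fun_prop) continuous_snd)).inter
          (isOpen_lt (by fun_prop) continuous_fst)) ⟨(s, y), ⟨s1, s2⟩, s3⟩ fun p hp => hp.1.1
      exact lt_asymm p2 (hp.2 p3)
    · exact heq
    · exfalso
      have hev : ∀ᶠ s in 𝓝 (K y), y < G s := hGc.continuousAt.eventually_const_lt hgt
      obtain ⟨s, ⟨s1, s2⟩, s3⟩ := ((hstrip.and hev).filter_mono nhdsWithin_le_nhds |>.and
        (self_mem_nhdsWithin : Iio (K y) ∈ 𝓝[<] (K y))).exists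
      obtain ⟨p, ⟨⟨p1, p2⟩, p3⟩, hp⟩ := hiff (U := strip θ ∩ {p | p.2 < G p.1} ∩ {p | p.1 < K p.2})
        ((hθ.isOpen_strip.inter (isOpen_lt continuous_snd (by fun_prop))).inter
          (isOpen_lt continuous_fst (by fun_prop))) ⟨(s, y), ⟨s1, s2⟩, s3⟩ fun p hp => hp.1.1
      exact lt_asymm p3 (hp.1 p2)

/-- A curve whose billiard has an invariant circle has nonvanishing curvature. -/
theorem curvature_ne_zero (h : IsClosedConvexCurve γ L) (hθ : IsTangentAngle γ L θ)
    (hC : IsLiftedCircle γ L θ C) (t₀ : ℝ) : curvature γ t₀ ≠ 0 := by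
  intro hk
  have hA : area (deriv γ t₀) (deriv (deriv γ) t₀) = 0 := by
    refine (div_eq_zero_iff.1 hk).resolve_right (pow_ne_zero _ (norm_ne_zero_iff.2 (h.regular t₀)))
  obtain ⟨G, K, M, hG, hKc, hGm, hKm, hKC, hGC, hH, hinv⟩ := hC.exists_graph h hθ
  obtain ⟨ε, hε, hgap⟩ := hC.exists_gap
  obtain ⟨m, hm, hmγ⟩ := exists_norm_deriv_ge h
  obtain ⟨δ, hδ, hθδ⟩ := hθ.uniformContinuous h (half_pos hε)
  have hεpi : ε ≤ Real.pi - ε := (hgap _ (hGC 0)).1.trans (hgap _ (hGC 0)).2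
  set c := m * m * Real.sin (ε / 2) with hc
  have hc0 : 0 < c := by
    have := Real.sin_pos_of_pos_of_lt_pi (half_pos hε) (by linarith)
    positivity
  obtain ⟨a, ha⟩ := exists_smul_of_area_eq_zero (h.regular t₀) hA
  obtain ⟨b, hb⟩ := exists_smul_of_area_eq_zero (v := γ (K t₀) - γ (G t₀)) (h.regular t₀) (by
    have := hH t₀
    simp only [height] at this
    rw [area_sub_right]
    linarith)
  -- Zero curvature makes `γ''` parallel to the tangent at `t₀`, and the orbit relation makes the
  -- chord parallel to it too, so the limiting area vanishes.
  have hlim : Tendsto (fun t => M * area (slope (deriv γ) t₀ t) (γ (K t) - γ (G t))) (𝓝[>] t₀)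
      (𝓝 0) := by
    have h1 := (hasDerivAt_iff_tendsto_slope.1 (h.hasDerivAt_deriv t₀)).mono_left
      (nhdsGT_le_nhdsNE t₀)
    have h2 : Tendsto (fun t => γ (K t) - γ (G t)) (𝓝[>] t₀) (𝓝 (γ (K t₀) - γ (G t₀))) :=
      (((h.continuous.comp hKc).sub (h.continuous.comp hG.continuous)).tendsto t₀).mono_left
        nhdsWithin_le_nhds
    have h3 := ((continuous_area.tendsto _).comp (h1.prodMk_nhds h2)).const_mul (M : ℝ)
    rw [ha, hb, area_smul_left, area_smul_right, area_self, mul_zero, mul_zero, mul_zero] at h3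
    exact h3
  have hev : ∀ᶠ t in 𝓝[>] t₀, c ≤ M * area (slope (deriv γ) t₀ t) (γ (K t) - γ (G t)) := by
    have hI : Ioo t₀ (t₀ + δ) ∈ 𝓝[>] t₀ := Ioo_mem_nhdsGT (by linarith)
    filter_upwards [hI] with t ht
    have hlt := ht.1
    have hd : 0 < t - t₀ := sub_pos.2 ht.1
    have h1 := hGm ht.1.le
    have h2 := hKm ht.1.le
    have key := hθ.twist_estimate h hm.le hmγ (half_pos hε) (hH t₀) (hH t) h2 h1
      (hθδ t t₀ (by rw [abs_of_pos hd]; linarith [ht.2]))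
      (by have := (hgap _ (hKC t₀)).2; simp only at this; linarith)
      (by have := (hgap _ (hGC t₀)).1; simp only at this; linarith)
      (by have := (hgap _ (hKC t)).1; simp only at this; linarith)
      (by have := (hgap _ (hGC t)).2; simp only at this; linarith)
    rw [← hc] at key
    -- The outgoing term of the twist estimate is discarded. As `G` is `M`-Lipschitz and inverts
    -- `K`, the incoming increment `K t - K t₀` satisfies `t - t₀ ≤ M * (K t - K t₀)`.
    have h3 : 0 ≤ c * (G t - G t₀) := mul_nonneg hc0.le (sub_nonneg.2 h1)
    have h4 := hG.dist_le_mul (K t) (K t₀)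
    rw [hinv, hinv, Real.dist_eq, Real.dist_eq, abs_of_pos hd, abs_of_nonneg (sub_nonneg.2 h2)] at h4
    have h5 : c * (t - t₀) ≤ M * area (deriv γ t - deriv γ t₀) (γ (K t) - γ (G t)) :=
      calc c * (t - t₀) ≤ c * (M * (K t - K t₀)) := by gcongr
        _ = M * (c * (K t - K t₀)) := by ring
        _ ≤ _ := by
          gcongr
          linarith
    simp only [slope, vsub_eq_sub, area_smul_left]
    rw [← div_eq_inv_mul, mul_div_assoc', le_div_iff₀ hd]
    exact h5
  exact absurd (ge_of_tendsto hlim hev) (not_le.2 hc0)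

end IsLiftedCircle

end SymplecticBilliard

theorem theorem2p2 (γ : ℝ → SymplecticBilliard.Plane) (L : ℝ)
    (hγ : SymplecticBilliard.IsClosedConvexCurve γ L)
    (t₀ : ℝ) (hk : SymplecticBilliard.curvature γ t₀ = 0) :
    ¬ SymplecticBilliard.HasCaustic γ := by
  rintro ⟨c, hc⟩
  obtain ⟨θ, hθ⟩ := hγ.exists_isTangentAngle
  exact (hc.isLiftedCircle hγ hθ).curvature_ne_zero hγ hθ t₀ hk
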